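/- Let $d\ge 2$ and $\lambda\in(0,1]$, and write $B_R=\{x\in\mathbb{R}^d:|x|<R\}$. A coefficient field is a Lebesgue-measurable, not necessarily symmetric, matrix field $A:\mathbb{R}^d\to\mathbb{R}^{d\times d}$ with $|A(x)\zeta|\le|\zeta|$ and $\lambda|\zeta|^2\le\zeta\cdot A(x)\zeta$ for all $x,\zeta\in\mathbb{R}^d$. For $T>0$ and $\xi\in\mathbb{R}^d$ with $|\xi|=1$, the modified corrector $\phi_T$ of $A$ in direction $\xi$ is the distributional solution on $\mathbb{R}^d$ of $T^{-1}\phi_T-\nabla\cdot A(\xi+\nabla\phi_T)=0$ in the class of functions $\chi\in H^1_{\mathrm{loc}}(\mathbb{R}^d)$ with $\limsup_{t\uparrow\infty}\frac{1}{|B_t|}\int_{B_t}(\chi^2+|\nabla\chi|^2)\,dx<\infty$. There exist an exponent $\alpha>0$ and a constant $C<\infty$, both depending only on $d$ and $\lambda$, such that for every coefficient field $A$ the following three statements hold. (i) For all $R\ge1$, $T>0$ and every $v\in H^1(B_R)$ satisfying $T^{-1}v-\nabla\cdot A\nabla v=0$ in the sense of distributions in $B_R$, $$\Big(\int_{B_1}(T^{-1}v^2+|\nabla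 v|^2)\,dx\Big)^{1/2}\le C R^{-\alpha}\Big(\int_{B_R}(T^{-1}v^2+|\nabla v|^2)\,dx\Big)^{1/2}.$$ (ii) For all $R>0$, $T>0$, $v\in H^1(\mathbb{R}^d)$ and $g\in L^2(\mathbb{R}^d,\mathbb{R}^d)$ satisfying $T^{-1}v-\nabla\cdot A\nabla v=\nabla\cdot g$ in the sense of distributions on $\mathbb{R}^d$, $$\Big(\int_{B_R}(T^{-1}v^2+|\nabla v|^2)\,dx\Big)^{1/2}\le C\Big(\int_{\mathbb{R}^d}\Big(\frac{|x|}{R}+1\Big)^{-2\alpha}|g(x)|^2\,dx\Big)^{1/2}.$$ (iii) For all $R\ge1$, $T>0$ and $\xi\in\mathbb{R}^d$ with $|\xi|=1$, the modified corrector $\phi_T$ of $A$ in direction $\xi$ satisfies $$\Big(\int_{B_1}\big(T^{-1}(\xi\cdot x+\phi_T(x))^2+|\xi+\nabla\phi_T(x)|^2\big)dx\Big)^{1/2}\le C R^{-\alpha}\Big(\int_{B_R}\big(T^{-1}(\xi\cdot x+\phi_T(x))^2+|\xi+\nabla\phi_T(x)|^2+T^{-1}R^2\big)dx\Big)^{1/2}.$$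 -/

import Mathlib

open MeasureTheory Filter
open scoped ContDiff

/-- The Euclidean space `ℝ^d`. -/
abbrev Euc (d : ℕ) : Type := EuclideanSpace ℝ (Fin d)

/-- The open ball `B_R` of radius `R` centred at the origin of `ℝ^d`. -/
abbrev originBall (d : ℕ) (R : ℝ) : Set (Euc d) := Metric.ball (0 : Euc d) R

/-- A coefficient field on `ℝ^d` with ellipticity constant `lam`: a Lebesgue measurable field of
`d × d` matrices (regarded as linear maps of `ℝ^d`) with `|A(x) ζ| ≤ |ζ|` and
`lam |ζ|² ≤ ζ · A(x) ζ` for all `x` and `ζ`. No symmetry is required. -/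
structure IsCoefficientField {d : ℕ} (lam : ℝ) (A : Euc d → (Euc d →L[ℝ] Euc d)) : Prop where
  aemeasurable : AEMeasurable A volume
  bounded : ∀ x ζ, ‖A x ζ‖ ≤ ‖ζ‖
  elliptic : ∀ x ζ, lam * ‖ζ‖ ^ 2 ≤ inner ℝ ζ (A x ζ)

/-- `η` is a smooth test function with compact support in `U`. -/
structure IsTestFunction {d : ℕ} (U : Set (Euc d)) (η : Euc d → ℝ) : Prop where
  contDiff : ContDiff ℝ ∞ η
  hasCompactSupport : HasCompactSupport η
  tsupport_subset : tsupport η ⊆ U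

/-- `v ∈ H¹(U)` with weak gradient `Dv` (`U` open): both are square integrable on `U`, and
`∫_U v ∂_e η = - ∫_U (Dv · e) η` for all test functions `η` and all directions `e`. -/
structure MemH1 {d : ℕ} (U : Set (Euc d)) (v : Euc d → ℝ) (Dv : Euc d → Euc d) : Prop where
  memLp : MemLp v 2 (volume.restrict U)
  memLp_grad : MemLp Dv 2 (volume.restrict U)
  weak_grad : ∀ η : Euc d → ℝ, IsTestFunction U η → ∀ e : Euc d,
    ∫ x in U, v x * fderiv ℝ η x e = - ∫ x in U, inner ℝ (Dv x) e * η x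

/-- `v ∈ H¹_loc(ℝ^d)` with weak gradient `Dv`. -/
def MemH1Loc {d : ℕ} (v : Euc d → ℝ) (Dv : Euc d → Euc d) : Prop :=
  ∀ r : ℝ, 0 < r → MemH1 (originBall d r) v Dv

/-- The equation `T⁻¹ v - ∇ · F = 0` in the sense of distributions on `U`:
`∫_U (T⁻¹ v η + ∇η · F) = 0` for all test functions `η`; here `fderiv ℝ η x (F x)` is
`∇η(x) · F(x)`. -/
def MassiveEq {d : ℕ} (U : Set (Euc d)) (T : ℝ) (v : Euc d → ℝ) (F : Euc d → Euc d) : Prop :=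
  ∀ η : Euc d → ℝ, IsTestFunction U η →
    ∫ x in U, (T⁻¹ * v x * η x + fderiv ℝ η x (F x)) = 0

/-- `φ` (with weak gradient `Dφ`) is the modified corrector of `A` in direction `ξ` with massive
parameter `T`: the distributional solution on `ℝ^d` of `T⁻¹ φ - ∇ · A (ξ + ∇φ) = 0` in the class
of functions in `H¹_loc(ℝ^d)` for which the averages over `B_t` of `φ² + |∇φ|²` have finite
limit superior as `t → ∞`. -/
structure IsModifiedCorrector {d : ℕ} (A : Euc d → (Euc d →L[ℝ] Euc d)) (ξ : Euc d) (T : ℝ)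
    (φ : Euc d → ℝ) (Dφ : Euc d → Euc d) : Prop where
  memH1Loc : MemH1Loc φ Dφ
  equation : MassiveEq Set.univ T φ (fun x => A x (ξ + Dφ x))
  growth : limsup (fun t : ℝ =>
    ⨍⁻ x in originBall d t, ENNReal.ofReal ((φ x) ^ 2 + ‖Dφ x‖ ^ 2) ∂volume) atTop < ⊤

/-! The engine is Widman's hole filling. Testing the equation with `χ²(v - c)`, where `χ` is a
cutoff equal to `1` on an inner ball, bounds the energy in that ball by three terms: `|∇χ|²(v -
c)²`, which lives on an annulus, `T⁻¹c²`, and the data. With `c` a mean of `v` over a small ball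
inside the annulus, Poincaré turns the first term into `|∇v|²` on the annulus, and Jensen bounds the
second by `T⁻¹v²` there. So the energy in `B_r` is at most `C` times the energy in `B_{5dr} \ B_r`
plus data; adding `C` times the energy in `B_r` to both sides gives a contraction with factor `θ =
C/(1+C) < 1`, uniform in `r`, `T`, `A`. This is `exists_hole_filling` and `exists_hasEnergyDecay`.

The contraction is proved for `T⁻¹(v - f) - ∇·(A∇v + g) = 0`, which covers all three statements: `f
= g = 0` in (i), `f = 0` in (ii), and in (iii) `v = ξ·x + φ_T`, `f = ξ·x`, `g = 0`. Iterating over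
the radii `(5d)^k` yields the power of `R` in (i) and (iii) (`le_rpow_mul_of_contraction`); in (ii)
the errors from the successive scales form a convergent geometric series.

Two tools carry the contraction. `MemH1.integral_eq_zero_of_forall_testFunction` admits compactly
supported `H¹` test functions, by mollification. `exists_poincare_annulus` covers the annulus by
convex caps, uses Poincaré on each, and compares caps through balls they share. -/

open scoped ENNReal Convolution

/-! ### Mollification in `L²` and density of test functions -/

/-- The Cauchy–Schwarz inequality for a nonnegative function against a finite mass. -/
theorem lintegral_sq_le_measure_univ_mul {X : Type*} [MeasurableSpace X] (μ : Measure X)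
    {g : X → ℝ≥0∞} (hg : AEMeasurable g μ) :
    (∫⁻ x, g x ∂μ) ^ 2 ≤ μ Set.univ * ∫⁻ x, g x ^ 2 ∂μ := by
  have h := ENNReal.lintegral_mul_le_Lp_mul_Lq μ Real.HolderConjugate.two_two
    (aemeasurable_const (b := (1 : ℝ≥0∞))) hg
  simp only [Pi.mul_apply, one_mul, one_pow, lintegral_const, ENNReal.rpow_two] at h
  calc (∫⁻ x, g x ∂μ) ^ 2
      ≤ (μ Set.univ ^ (1 / 2 : ℝ) * (∫⁻ x, g x ^ 2 ∂μ) ^ (1 / 2 : ℝ)) ^ 2 := by gcongr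
    _ = _ := by
      rw [mul_pow, ← ENNReal.rpow_natCast, ← ENNReal.rpow_natCast, ← ENNReal.rpow_mul,
        ← ENNReal.rpow_mul]
      norm_num

/-- The weighted form of the Cauchy–Schwarz inequality. -/
theorem lintegral_mul_sq_le {X : Type*} [MeasurableSpace X] (μ : Measure X)
    {a g : X → ℝ≥0∞} (ha : Measurable a) (hg : AEMeasurable g μ) :
    (∫⁻ x, a x * g x ∂μ) ^ 2 ≤ (∫⁻ x, a x ∂μ) * ∫⁻ x, a x * g x ^ 2 ∂μ := by
  have h := lintegral_sq_le_measure_univ_mul (μ.withDensity a)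
    (hg.mono_ac (withDensity_absolutelyContinuous μ a))
  rw [withDensity_apply _ MeasurableSet.univ, Measure.restrict_univ] at h
  rwa [lintegral_withDensity_eq_lintegral_mul₀ ha.aemeasurable hg,
    lintegral_withDensity_eq_lintegral_mul₀ ha.aemeasurable (hg.pow_const 2)] at h

theorem eLpNorm_two_sq {X F : Type*} [MeasurableSpace X] [NormedAddCommGroup F] (μ : Measure X)
    (f : X → F) : eLpNorm f 2 μ ^ 2 = ∫⁻ x, ‖f x‖ₑ ^ 2 ∂μ := by
  have h := eLpNorm_nnreal_pow_eq_lintegral (μ := μ) (f := f) (p := 2) two_ne_zero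
  simpa using h

/-- Translations act continuously on `L²`. -/
theorem exists_lintegral_translate_sub_le {d : ℕ} {F : Type*} [NormedAddCommGroup F]
    {f : Euc d → F} (hf : MemLp f 2 volume) {ε : ℝ≥0∞}
    (hε : ε ≠ 0) :
    ∃ δ > 0, ∀ y : Euc d, ‖y‖ < δ → ∫⁻ x, ‖f (x - y) - f x‖ₑ ^ 2 ≤ ε := by
  have : Fact ((2 : ℝ≥0∞) ≠ ⊤) := ⟨by norm_num⟩
  -- `DomAddAct.mk (-y)` acts by `f ↦ f(-y + ·)`, the translation needed here, and this action on
  -- `Lp` is continuous for finite exponents.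
  let G : Euc d → Lp F 2 (volume : Measure (Euc d)) :=
    fun y => DomAddAct.mk (-y) +ᵥ hf.toLp f
  have hG : Continuous G := by
    have : Continuous fun y : Euc d => DomAddAct.mk (-y) :=
      DomAddAct.continuous_mk.comp continuous_neg
    exact this.vadd continuous_const
  obtain ⟨η, hη, hηε⟩ : ∃ η : ℝ≥0∞, 0 < η ∧ η ^ 2 ≤ ε := by
    have : Tendsto (fun t : ℝ≥0∞ => t ^ 2) (nhds 0) (nhds (0 ^ 2)) :=
      (ENNReal.continuous_pow 2).tendsto 0
    rw [zero_pow two_ne_zero] at this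
    have h2 := this.eventually (Iic_mem_nhds (pos_iff_ne_zero.2 hε))
    have h3 : ∀ᶠ t in nhdsWithin (0 : ℝ≥0∞) (Set.Ioi 0), t ^ 2 ≤ ε :=
      h2.filter_mono nhdsWithin_le_nhds
    obtain ⟨t, ht⟩ := (h3.and self_mem_nhdsWithin).exists
    exact ⟨t, ht.2, ht.1⟩
  have h1 := (hG.tendsto 0).eventually (Metric.eball_mem_nhds (G 0) hη)
  obtain ⟨δ, hδ, hb⟩ := Metric.eventually_nhds_iff.1 h1
  refine ⟨δ, hδ, fun y hy => le_trans ?_ hηε⟩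
  have h2 := hb (y := y) (by simpa using hy)
  simp only [G, DomAddAct.mk_vadd_toLp, Lp.edist_def] at h2
  rw [← eLpNorm_two_sq]
  gcongr
  refine le_trans (le_of_eq (eLpNorm_congr_ae ?_)) h2.le
  have hτ : ∀ z : Euc d, MemLp (fun x => f (-z +ᵥ x)) 2 volume := fun z =>
    hf.comp_measurePreserving (measurePreserving_vadd (-z) volume)
  filter_upwards [MemLp.coeFn_toLp (hτ y), MemLp.coeFn_toLp (hτ 0)] with x hx hx0
  simp only [Pi.sub_apply]
  erw [hx, hx0]
  simp [sub_eq_neg_add]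

/-- Mollification converges in `L²`. -/
theorem exists_lintegral_mollify_sub_le {d : ℕ} {F : Type*} [NormedAddCommGroup F]
    [NormedSpace ℝ F] [CompleteSpace F] {f : Euc d → F} (hf : MemLp f 2 volume) {ε : ℝ≥0∞}
    (hε : ε ≠ 0) :
    ∃ δ > 0, ∀ φ : ContDiffBump (0 : Euc d), φ.rOut < δ →
      ∫⁻ x, ‖(∫ t, φ.normed volume t • f (x - t)) - f x‖ₑ ^ 2 ≤ ε := by
  obtain ⟨δ, hδ, h⟩ := exists_lintegral_translate_sub_le hf hε
  refine ⟨δ, hδ, fun φ hφ => ?_⟩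
  set ρ := φ.normed (volume : Measure (Euc d)) with hρ
  have hρc : Continuous ρ := φ.continuous_normed
  have hρs : HasCompactSupport ρ := φ.hasCompactSupport_normed
  have hρ1 : ∫⁻ t, ‖ρ t‖ₑ = 1 := by
    have h1 : ∫ t, ρ t = 1 := φ.integral_normed
    have h2 : ENNReal.ofReal (∫ t, ρ t) = ∫⁻ t, ENNReal.ofReal (ρ t) :=
      ofReal_integral_eq_lintegral_ofReal φ.integrable_normed
        (Eventually.of_forall fun t => φ.nonneg_normed t)
    rw [h1, ENNReal.ofReal_one] at h2
    rw [h2]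
    exact lintegral_congr fun t => Real.enorm_of_nonneg (φ.nonneg_normed t)
  have hmeas : AEStronglyMeasurable (fun p : Euc d × Euc d => f (p.1 - p.2) - f p.1)
      (volume.prod volume) :=
    (hf.1.comp_quasiMeasurePreserving
      (quasiMeasurePreserving_sub_of_right_invariant volume volume)).sub hf.1.comp_fst
  have hfl : LocallyIntegrable f volume := hf.locallyIntegrable (by norm_num)
  -- `ρ dt` is a probability measure, so Jensen moves the square inside; Tonelli then reduces the
  -- claim to translations by `t` in the support of `ρ`.
  have key : ∀ᵐ x : Euc d, ‖(∫ t, ρ t • f (x - t)) - f x‖ₑ ^ 2 ≤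
      ∫⁻ t, ‖ρ t‖ₑ * ‖f (x - t) - f x‖ₑ ^ 2 := by
    filter_upwards [hmeas.prodMk_left] with x hx
    have hint : Integrable (fun t => ρ t • f (x - t)) :=
      hρs.convolutionExists_left (ContinuousLinearMap.lsmul ℝ ℝ) hρc hfl x
    have e1 : (∫ t, ρ t • f (x - t)) - f x = ∫ t, ρ t • (f (x - t) - f x) := by
      simp_rw [smul_sub]
      rw [integral_sub hint (φ.integrable_normed.smul_const _), integral_smul_const,
        φ.integral_normed, one_smul]
    rw [e1]
    calc ‖∫ t, ρ t • (f (x - t) - f x)‖ₑ ^ 2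
        ≤ (∫⁻ t, ‖ρ t‖ₑ * ‖f (x - t) - f x‖ₑ) ^ 2 := by
          gcongr
          refine (enorm_integral_le_lintegral_enorm _).trans_eq ?_
          simp_rw [enorm_smul]
      _ ≤ (∫⁻ t, ‖ρ t‖ₑ) * ∫⁻ t, ‖ρ t‖ₑ * ‖f (x - t) - f x‖ₑ ^ 2 :=
          lintegral_mul_sq_le _ hρc.enorm.measurable hx.enorm
      _ = _ := by rw [hρ1, one_mul]
  calc ∫⁻ x, ‖(∫ t, ρ t • f (x - t)) - f x‖ₑ ^ 2
      ≤ ∫⁻ x, ∫⁻ t, ‖ρ t‖ₑ * ‖f (x - t) - f x‖ₑ ^ 2 := lintegral_mono_ae key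
    _ = ∫⁻ t, ∫⁻ x, ‖ρ t‖ₑ * ‖f (x - t) - f x‖ₑ ^ 2 := by
        refine lintegral_lintegral_swap ?_
        exact (hρc.enorm.measurable.comp measurable_snd).aemeasurable.mul (hmeas.enorm.pow_const 2)
    _ = ∫⁻ t, ‖ρ t‖ₑ * ∫⁻ x, ‖f (x - t) - f x‖ₑ ^ 2 :=
        lintegral_congr fun t => lintegral_const_mul' _ _ (by simp)
    _ ≤ ∫⁻ t, ‖ρ t‖ₑ * ε := by
        refine lintegral_mono fun t => ?_
        by_cases ht : ‖t‖ < δ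
        · exact mul_le_mul_right (h t ht) _
        · have : ρ t = 0 := by
            by_contra hne
            have : t ∈ Function.support ρ := hne
            rw [hρ, φ.support_normed_eq] at this
            have := mem_ball_zero_iff.1 this
            linarith
          simp [this]
    _ = ε := by rw [lintegral_mul_const _ hρc.enorm.measurable, hρ1, one_mul]

/-- Mollification commutes with the weak gradient. -/
theorem MemH1.gradient_mollify {d : ℕ} {w : Euc d → ℝ} {Dw : Euc d → Euc d}
    (h : MemH1 Set.univ w Dw) (φ : ContDiffBump (0 : Euc d)) (x : Euc d) :
    gradient (fun x => ∫ t, φ.normed volume t • w (x - t)) x =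
      ∫ t, φ.normed volume t • Dw (x - t) := by
  set ρ := φ.normed (volume : Measure (Euc d)) with hρ
  have hρd : ContDiff ℝ ∞ ρ := φ.contDiff_normed
  have hρs : HasCompactSupport ρ := φ.hasCompactSupport_normed
  have hw : LocallyIntegrable w volume := by
    have := h.memLp; rw [Measure.restrict_univ] at this
    exact this.locallyIntegrable (by norm_num)
  have hDw : LocallyIntegrable Dw volume := by
    have := h.memLp_grad; rw [Measure.restrict_univ] at this
    exact this.locallyIntegrable (by norm_num)
  have hfd := hρs.hasFDerivAt_convolution_left (ContinuousLinearMap.lsmul ℝ ℝ)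
    (hρd.of_le (by norm_cast)) hw x
  have hfun : (ρ ⋆[ContinuousLinearMap.lsmul ℝ ℝ, volume] w) =
      fun x => ∫ t, ρ t • w (x - t) := rfl
  rw [hfun] at hfd
  have hint : Integrable (fun t => ρ t • Dw (x - t)) :=
    hρs.convolutionExists_left (ContinuousLinearMap.lsmul ℝ ℝ) hρd.continuous hDw x
  have hint2 := (hρs.fderiv (𝕜 := ℝ)).convolutionExists_left
    (ContinuousLinearMap.precompL (Euc d) (ContinuousLinearMap.lsmul ℝ ℝ))
    (hρd.continuous_fderiv (by simp)) hw x
  refine ext_inner_right ℝ fun e => ?_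
  rw [inner_gradient_left, hfd.fderiv, convolution_def, ContinuousLinearMap.integral_apply hint2]
  -- The weak gradient is tested with the reflected kernel; the sign from differentiating `x - y`
  -- cancels the sign of integration by parts.
  have htest : IsTestFunction Set.univ (fun y => ρ (x - y)) := by
    refine ⟨hρd.comp (contDiff_const.sub contDiff_id), ?_, Set.subset_univ _⟩
    exact hρs.comp_homeomorph (Homeomorph.subLeft x)
  have hwk := h.weak_grad _ htest e
  have hder : ∀ y, fderiv ℝ (fun y => ρ (x - y)) y e = - fderiv ℝ ρ (x - y) e := by
    intro y
    have h1 : HasFDerivAt ρ (fderiv ℝ ρ (x - y)) (x - y) :=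
      (hρd.differentiable (by simp) _).hasFDerivAt
    have h2 := h1.comp y ((hasFDerivAt_id y).const_sub x)
    have h3 : fderiv ℝ (fun y => ρ (x - y)) y = _ := h2.fderiv
    rw [h3]; simp
  simp only [hder, Measure.restrict_univ] at hwk
  have e1 : ∫ t, (ContinuousLinearMap.precompL (Euc d) (ContinuousLinearMap.lsmul ℝ ℝ)
      (fderiv ℝ ρ t) (w (x - t))) e = ∫ y, w y * fderiv ℝ ρ (x - y) e := by
    rw [← integral_sub_left_eq_self (fun y => w y * fderiv ℝ ρ (x - y) e) volume x]
    refine integral_congr_ae (Eventually.of_forall fun t => ?_)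
    simp [ContinuousLinearMap.precompL_apply, mul_comm]
  have e2 : inner ℝ (∫ t, ρ t • Dw (x - t)) e = ∫ y, inner ℝ (Dw y) e * ρ (x - y) := by
    rw [← integral_sub_left_eq_self (fun y => inner ℝ (Dw y) e * ρ (x - y)) volume x,
      real_inner_comm, ← integral_inner hint]
    refine integral_congr_ae (Eventually.of_forall fun t => ?_)
    simp [inner_smul_right, mul_comm, real_inner_comm]
  rw [e1, e2]
  simp only [mul_neg, integral_neg] at hwk
  linarith

/-- An `H¹` function vanishing outside a compact subset of `U` is a limit of test functions. -/
theorem MemH1.exists_testFunction_approx {d : ℕ} {U K : Set (Euc d)} {w : Euc d → ℝ}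
    {Dw : Euc d → Euc d} (h : MemH1 Set.univ w Dw) (hU : IsOpen U) (hK : IsCompact K)
    (hKU : K ⊆ U) (hw : ∀ x ∉ K, w x = 0) {ε : ℝ≥0∞} (hε : ε ≠ 0) :
    ∃ η, IsTestFunction U η ∧ ∫⁻ x, ‖η x - w x‖ₑ ^ 2 ≤ ε ∧
      ∫⁻ x, ‖gradient η x - Dw x‖ₑ ^ 2 ≤ ε := by
  have hw2 : MemLp w 2 volume := by simpa using h.memLp
  have hDw2 : MemLp Dw 2 volume := by simpa using h.memLp_grad
  obtain ⟨δ₁, hδ₁, h1⟩ := exists_lintegral_mollify_sub_le hw2 hε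
  obtain ⟨δ₂, hδ₂, h2⟩ := exists_lintegral_mollify_sub_le hDw2 hε
  obtain ⟨δ₃, hδ₃, h3⟩ := hK.exists_cthickening_subset_open hU hKU
  -- `δ₁`, `δ₂` control the two `L²` errors, and `δ₃` keeps the mollified function supported in `U`.
  set δ := min δ₁ (min δ₂ δ₃)
  have hδ : 0 < δ := lt_min hδ₁ (lt_min hδ₂ hδ₃)
  let φ : ContDiffBump (0 : Euc d) := ⟨δ / 4, δ / 2, by linarith, by linarith⟩
  have hφ : φ.rOut < δ := by change δ / 2 < δ; linarith
  have hφ1 : φ.rOut < δ₁ := hφ.trans_le (min_le_left _ _)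
  have hφ2 : φ.rOut < δ₂ := hφ.trans_le ((min_le_right _ _).trans (min_le_left _ _))
  have hφ3 : φ.rOut < δ₃ := hφ.trans_le ((min_le_right _ _).trans (min_le_right _ _))
  have hzero : ∀ x ∉ Metric.cthickening δ₃ K, ∫ t, φ.normed volume t • w (x - t) = 0 := by
    intro x hx
    refine integral_eq_zero_of_ae (Eventually.of_forall fun t => ?_)
    by_cases ht : φ.normed volume t = 0
    · simp [ht]
    · have ht' : t ∈ Function.support (φ.normed (volume : Measure (Euc d))) := ht
      rw [φ.support_normed_eq, mem_ball_zero_iff] at ht'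
      have : w (x - t) = 0 := by
        refine hw _ fun hmem => hx ?_
        refine Metric.mem_cthickening_of_dist_le x (x - t) δ₃ K hmem ?_
        rw [dist_eq_norm, sub_sub_cancel]
        linarith
      simp [this]
  have hts : tsupport (fun x => ∫ t, φ.normed volume t • w (x - t)) ⊆
      Metric.cthickening δ₃ K := by
    refine closure_minimal (fun x hx => ?_) Metric.isClosed_cthickening
    by_contra hc
    exact hx (hzero x hc)
  refine ⟨fun x => ∫ t, φ.normed volume t • w (x - t), ⟨?_, ?_, hts.trans h3⟩, h1 φ hφ1, ?_⟩
  · exact φ.hasCompactSupport_normed.contDiff_convolution_left (ContinuousLinearMap.lsmul ℝ ℝ)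
      (n := ⊤) φ.contDiff_normed (hw2.locallyIntegrable (by norm_num))
  · exact hK.cthickening.of_isClosed_subset (isClosed_tsupport _) hts
  · simp_rw [h.gradient_mollify φ]
    exact h2 φ hφ2

/-! ### Cutoffs, Leibniz rule, and `H¹` test functions in the equation -/

theorem fderiv_mul_apply_of_contDiff {d : ℕ} {f g : Euc d → ℝ} (hf : ContDiff ℝ ∞ f)
    (hg : ContDiff ℝ ∞ g) (x e : Euc d) :
    fderiv ℝ (fun x => f x * g x) x e = f x * fderiv ℝ g x e + g x * fderiv ℝ f x e := by
  have h := ((hf.differentiable (by simp) x).hasFDerivAt.mul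
    (hg.differentiable (by simp) x).hasFDerivAt).fderiv
  have h' : fderiv ℝ (fun x => f x * g x) x = f x • fderiv ℝ g x + g x • fderiv ℝ f x := h
  rw [h']; simp

theorem IsTestFunction.mul {d : ℕ} {U : Set (Euc d)} {χ η : Euc d → ℝ} (hχ : IsTestFunction U χ)
    (hη : ContDiff ℝ ∞ η) : IsTestFunction U (fun x => χ x * η x) :=
  ⟨hχ.contDiff.mul hη, hχ.hasCompactSupport.mul_right,
    (tsupport_mul_subset_left).trans hχ.tsupport_subset⟩

theorem IsTestFunction.mono {d : ℕ} {U V : Set (Euc d)} {χ : Euc d → ℝ} (hχ : IsTestFunction U χ)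
    (hUV : U ⊆ V) : IsTestFunction V χ :=
  ⟨hχ.contDiff, hχ.hasCompactSupport, hχ.tsupport_subset.trans hUV⟩

theorem IsTestFunction.eq_zero {d : ℕ} {U : Set (Euc d)} {χ : Euc d → ℝ}
    (hχ : IsTestFunction U χ) {x : Euc d} (hx : x ∉ U) : χ x = 0 :=
  image_eq_zero_of_notMem_tsupport fun h => hx (hχ.tsupport_subset h)

theorem IsTestFunction.fderiv_eq_zero {d : ℕ} {U : Set (Euc d)} {χ : Euc d → ℝ}
    (hχ : IsTestFunction U χ) {x : Euc d} (hx : x ∉ U) : fderiv ℝ χ x = 0 :=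
  image_eq_zero_of_notMem_tsupport
    fun h => hx (hχ.tsupport_subset (tsupport_fderiv_subset ℝ h))

theorem IsTestFunction.gradient_eq_zero {d : ℕ} {U : Set (Euc d)} {χ : Euc d → ℝ}
    (hχ : IsTestFunction U χ) {x : Euc d} (hx : x ∉ U) : gradient χ x = 0 := by
  simp [gradient, hχ.fderiv_eq_zero hx]

theorem norm_gradient {d : ℕ} (χ : Euc d → ℝ) (x : Euc d) : ‖gradient χ x‖ = ‖fderiv ℝ χ x‖ := by
  simp [gradient]

theorem ContDiff.continuous_gradient_euc {d : ℕ} {χ : Euc d → ℝ} (hχ : ContDiff ℝ 1 χ) :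
    Continuous (gradient χ) :=
  (InnerProductSpace.toDual ℝ (Euc d)).symm.continuous.comp (hχ.continuous_fderiv (by simp))

theorem IsTestFunction.continuous_gradient {d : ℕ} {U : Set (Euc d)} {χ : Euc d → ℝ}
    (hχ : IsTestFunction U χ) : Continuous (gradient χ) :=
  (hχ.contDiff.of_le (by norm_cast)).continuous_gradient_euc

theorem IsTestFunction.hasCompactSupport_gradient {d : ℕ} {U : Set (Euc d)} {χ : Euc d → ℝ}
    (hχ : IsTestFunction U χ) : HasCompactSupport (gradient χ) :=
  (hχ.hasCompactSupport.fderiv (𝕜 := ℝ)).comp_left (g := (InnerProductSpace.toDual ℝ (Euc d)).symm)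
    (map_zero _)

theorem IsTestFunction.memLp {d : ℕ} {U : Set (Euc d)} {χ : Euc d → ℝ}
    (hχ : IsTestFunction U χ) : MemLp χ 2 volume :=
  hχ.contDiff.continuous.memLp_of_hasCompactSupport hχ.hasCompactSupport

theorem IsTestFunction.memLp_gradient {d : ℕ} {U : Set (Euc d)} {χ : Euc d → ℝ}
    (hχ : IsTestFunction U χ) : MemLp (gradient χ) 2 volume :=
  hχ.continuous_gradient.memLp_of_hasCompactSupport hχ.hasCompactSupport_gradient

/-- Multiplication by a bounded continuous function supported in `U` extends square integrable
functions on `U` by zero. -/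
theorem MemLp.continuous_smul_of_restrict {d : ℕ} {F : Type*} [NormedAddCommGroup F]
    [NormedSpace ℝ F] {U : Set (Euc d)} (hU : MeasurableSet U) {f : Euc d → F}
    (hf : MemLp f 2 (volume.restrict U)) {χ : Euc d → ℝ} (hχ : Continuous χ)
    (hχs : HasCompactSupport χ) (hχU : ∀ x ∉ U, χ x = 0) :
    MemLp (fun x => χ x • f x) 2 volume := by
  have h1 : MemLp (U.indicator f) 2 volume := (memLp_indicator_iff_restrict hU).2 hf
  have h2 : MemLp χ ∞ volume := hχ.memLp_of_hasCompactSupport hχs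
  have h3 : MemLp (χ • U.indicator f) 2 volume := h1.smul h2
  convert h3 using 1
  funext x
  by_cases hx : x ∈ U
  · simp [hx]
  · simp [hx, hχU x hx]

theorem MemLp.smul_continuous_of_restrict {d : ℕ} {F : Type*} [NormedAddCommGroup F]
    [NormedSpace ℝ F] {U : Set (Euc d)} (hU : MeasurableSet U) {f : Euc d → ℝ}
    (hf : MemLp f 2 (volume.restrict U)) {χ : Euc d → F} (hχ : Continuous χ)
    (hχs : HasCompactSupport χ) (hχU : ∀ x ∉ U, χ x = 0) :
    MemLp (fun x => f x • χ x) 2 volume := by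
  have h1 : MemLp (U.indicator f) 2 volume := (memLp_indicator_iff_restrict hU).2 hf
  have h2 : MemLp χ ∞ volume := hχ.memLp_of_hasCompactSupport hχs
  have h3 : MemLp (U.indicator f • χ) 2 volume := h2.smul h1
  convert h3 using 1
  funext x
  by_cases hx : x ∈ U
  · simp [hx]
  · simp [hx, hχU x hx]

theorem integral_eq_setIntegral_of_forall_notMem {d : ℕ} {U : Set (Euc d)} {f : Euc d → ℝ}
    (hf : ∀ x ∉ U, f x = 0) : ∫ x in U, f x = ∫ x, f x :=
  setIntegral_eq_integral_of_forall_compl_eq_zero hf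

/-- The Leibniz rule for the product of an `H¹(U)` function with a test function, extended by
zero to the whole space. -/
theorem MemH1.testFunction_mul {d : ℕ} {U : Set (Euc d)} {v : Euc d → ℝ} {Dv : Euc d → Euc d}
    (h : MemH1 U v Dv) (hU : MeasurableSet U) {χ : Euc d → ℝ} (hχ : IsTestFunction U χ) :
    MemH1 Set.univ (fun x => χ x * v x) (fun x => χ x • Dv x + v x • gradient χ x) := by
  have hv := MemLp.continuous_smul_of_restrict hU h.memLp hχ.contDiff.continuous
    hχ.hasCompactSupport fun x hx => hχ.eq_zero hx
  have hDv := MemLp.continuous_smul_of_restrict hU h.memLp_grad hχ.contDiff.continuous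
    hχ.hasCompactSupport fun x hx => hχ.eq_zero hx
  have hvg := MemLp.smul_continuous_of_restrict hU h.memLp hχ.continuous_gradient
    hχ.hasCompactSupport_gradient fun x hx => hχ.gradient_eq_zero hx
  refine ⟨by simpa using hv, by rw [Measure.restrict_univ]; exact hDv.add hvg,
    fun η hη e => ?_⟩
  have hχη := hχ.mul hη.contDiff
  have hw := h.weak_grad _ hχη e
  simp only [Measure.restrict_univ]
  rw [integral_eq_setIntegral_of_forall_notMem fun x hx => by
      rw [hχη.fderiv_eq_zero hx]; simp,
    integral_eq_setIntegral_of_forall_notMem fun x hx => by rw [hχη.eq_zero hx]; simp] at hw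
  have hη' : MemLp η 2 volume := hη.memLp
  have hηe : MemLp (fun x => fderiv ℝ η x e) 2 volume := by
    have := hη.memLp_gradient.inner_const (𝕜 := ℝ) e
    simpa only [inner_gradient_left] using this
  have i1 : Integrable (fun x => χ x • v x * fderiv ℝ η x e) := hv.integrable_mul hηe
  have i2 : Integrable (fun x => inner ℝ (χ x • Dv x) e * η x) :=
    (hDv.inner_const (𝕜 := ℝ) e).integrable_mul hη'
  have i3 : Integrable (fun x => inner ℝ (v x • gradient χ x) e * η x) :=
    (hvg.inner_const (𝕜 := ℝ) e).integrable_mul hη'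
  have e1 : ∫ x, v x * fderiv ℝ (fun x => χ x * η x) x e =
      (∫ x, χ x • v x * fderiv ℝ η x e) + ∫ x, inner ℝ (v x • gradient χ x) e * η x := by
    rw [← integral_add i1 i3]
    refine integral_congr_ae (Eventually.of_forall fun x => ?_)
    simp only [fderiv_mul_apply_of_contDiff hχ.contDiff hη.contDiff, real_inner_smul_left,
      inner_gradient_left, smul_eq_mul]
    ring
  have e2 : ∫ x, inner ℝ (χ x • Dv x + v x • gradient χ x) e * η x =
      (∫ x, inner ℝ (χ x • Dv x) e * η x) + ∫ x, inner ℝ (v x • gradient χ x) e * η x := by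
    rw [← integral_add i2 i3]
    refine integral_congr_ae (Eventually.of_forall fun x => ?_)
    simp only [inner_add_left, add_mul]
  have e3 : ∫ x, inner ℝ (Dv x) e * (χ x * η x) = ∫ x, inner ℝ (χ x • Dv x) e * η x := by
    refine integral_congr_ae (Eventually.of_forall fun x => ?_)
    simp only [real_inner_smul_left]
    ring
  rw [e1, e3] at hw
  rw [e2]
  simp only [smul_eq_mul] at hw ⊢
  linarith

theorem integral_fderiv_testFunction {d : ℕ} {U : Set (Euc d)} {η : Euc d → ℝ}
    (hη : IsTestFunction U η) (e : Euc d) : ∫ x, fderiv ℝ η x e = 0 := by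
  have hc : Continuous fun x => fderiv ℝ η x e :=
    (hη.contDiff.continuous_fderiv (by simp)).clm_apply continuous_const
  have hs : HasCompactSupport fun x => fderiv ℝ η x e :=
    (hη.hasCompactSupport.fderiv (𝕜 := ℝ)).comp_left (g := fun L : Euc d →L[ℝ] ℝ => L e) rfl
  have hi := hη.contDiff.continuous.integrable_of_hasCompactSupport (μ := volume)
    hη.hasCompactSupport
  have := integral_mul_fderiv_eq_neg_fderiv_mul_of_integrable (𝕜 := ℝ) (μ := volume)
    (f := fun _ : Euc d => (1 : ℝ)) (g := η) (v := e) (by simp)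
    (by simpa using hc.integrable_of_hasCompactSupport hs) (by simpa using hi)
    (fun x _ => differentiableAt_const _) (fun x _ => hη.contDiff.differentiable (by simp) x)
  simpa using this

/-- Finite volume makes constants square integrable, and the weak gradient is unaffected because
derivatives of test functions have integral zero. -/
theorem MemH1.sub_const {d : ℕ} {U : Set (Euc d)} {v : Euc d → ℝ} {Dv : Euc d → Euc d}
    (h : MemH1 U v Dv) (hU : volume U ≠ ⊤) (c : ℝ) :
    MemH1 U (fun x => v x - c) Dv := by
  have : IsFiniteMeasure (volume.restrict U) := ⟨by simpa using hU.lt_top⟩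
  refine ⟨h.memLp.sub (memLp_const c), h.memLp_grad, fun η hη e => ?_⟩
  rw [← h.weak_grad η hη e]
  have hηe : MemLp (fun x => fderiv ℝ η x e) 2 volume := by
    have := hη.memLp_gradient.inner_const (𝕜 := ℝ) e
    simpa only [inner_gradient_left] using this
  have h0 : ∫ x in U, c * fderiv ℝ η x e = 0 := by
    rw [integral_const_mul, integral_eq_setIntegral_of_forall_notMem fun x hx => by
      rw [hη.fderiv_eq_zero hx]; simp, integral_fderiv_testFunction hη, mul_zero]
  simp_rw [sub_mul]
  have i1 : Integrable (fun x => v x * fderiv ℝ η x e) (volume.restrict U) :=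
    h.memLp.integrable_mul (hηe.restrict U)
  have i2 : Integrable (fun x => c * fderiv ℝ η x e) (volume.restrict U) :=
    (memLp_const (p := 2) c).integrable_mul (hηe.restrict U)
  rw [integral_sub i1 i2, h0, sub_zero]

theorem integrable_norm_sq {X F : Type*} [MeasurableSpace X] [NormedAddCommGroup F]
    {μ : Measure X} {f : X → F} (hf : MemLp f 2 μ) : Integrable (fun x => ‖f x‖ ^ 2) μ :=
  MemLp.integrable_norm_pow (p := 2) hf two_ne_zero

theorem integrable_inner_of_memLp {X F : Type*} [MeasurableSpace X] [NormedAddCommGroup F]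
    [InnerProductSpace ℝ F] {μ : Measure X} {f g : X → F} (hf : MemLp f 2 μ) (hg : MemLp g 2 μ) :
    Integrable (fun x => inner ℝ (f x) (g x)) μ := by
  refine ((integrable_norm_sq hf).fun_add (integrable_norm_sq hg)).mono' (hf.1.inner hg.1)
    (Eventually.of_forall fun x => ?_)
  have := norm_inner_le_norm (𝕜 := ℝ) (f x) (g x)
  nlinarith [sq_nonneg (‖f x‖ - ‖g x‖), sq_nonneg (‖f x‖ + ‖g x‖)]

theorem integral_norm_sq_le_of_lintegral_enorm_sq_le {X F : Type*} [MeasurableSpace X]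
    [NormedAddCommGroup F] {μ : Measure X} {f : X → F} (hf : AEStronglyMeasurable f μ) {c : ℝ}
    (hc : 0 ≤ c) (h : ∫⁻ x, ‖f x‖ₑ ^ 2 ∂μ ≤ ENNReal.ofReal c) : ∫ x, ‖f x‖ ^ 2 ∂μ ≤ c := by
  rw [integral_eq_lintegral_of_nonneg_ae (Eventually.of_forall fun x => by positivity)
    (hf.norm.fun_pow 2)]
  refine ENNReal.toReal_le_of_le_ofReal hc (le_trans (le_of_eq ?_) h)
  refine lintegral_congr fun x => ?_
  rw [ENNReal.ofReal_pow (norm_nonneg _), ofReal_norm]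

theorem lintegral_enorm_sq_eq_ofReal {X F : Type*} [MeasurableSpace X]
    [NormedAddCommGroup F] {μ : Measure X} {f : X → F} (hf : MemLp f 2 μ) :
    ∫⁻ x, ‖f x‖ₑ ^ 2 ∂μ = ENNReal.ofReal (∫ x, ‖f x‖ ^ 2 ∂μ) := by
  rw [ofReal_integral_eq_lintegral_ofReal (integrable_norm_sq hf)
    (Eventually.of_forall fun x => by positivity)]
  refine lintegral_congr fun x => ?_
  rw [ENNReal.ofReal_pow (norm_nonneg _), ofReal_norm]

/-- A distributional identity extends from test functions to compactly supported `H¹`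
functions. -/
theorem MemH1.integral_eq_zero_of_forall_testFunction {d : ℕ} {U K : Set (Euc d)}
    {a : Euc d → ℝ} {G : Euc d → Euc d} (hU : IsOpen U) (ha : MemLp a 2 (volume.restrict U))
    (hG : MemLp G 2 (volume.restrict U))
    (heq : ∀ η, IsTestFunction U η → ∫ x in U, (a x * η x + fderiv ℝ η x (G x)) = 0)
    (hK : IsCompact K) (hKU : K ⊆ U) {w : Euc d → ℝ} {Dw : Euc d → Euc d}
    (hw : MemH1 Set.univ w Dw) (hwK : ∀ x ∉ K, w x = 0) :
    ∫ x in U, (a x * w x + inner ℝ (Dw x) (G x)) = 0 := by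
  have hw2 : MemLp w 2 volume := by simpa using hw.memLp
  have hDw2 : MemLp Dw 2 volume := by simpa using hw.memLp_grad
  set M := (∫ x in U, ‖a x‖ ^ 2) + ∫ x in U, ‖G x‖ ^ 2 with hM
  have hM0 : 0 ≤ M := add_nonneg (integral_nonneg fun x => by positivity)
    (integral_nonneg fun x => by positivity)
  -- Approximating `w` with squared error `t²` and applying Young with weights `t`, `t⁻¹` gives `t *
  -- M + t⁻¹ * 2t² = t * (M + 2)`, arbitrarily small.
  have key : ∀ t : ℝ, 0 < t → |∫ x in U, (a x * w x + inner ℝ (Dw x) (G x))| ≤ t * (M + 2) := by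
    intro t ht
    obtain ⟨η, hη, h1, h2⟩ := hw.exists_testFunction_approx hU hK hKU hwK
      (ε := ENNReal.ofReal (t ^ 2)) (by simpa using ht.ne')
    have m1 : MemLp (fun x => η x - w x) 2 volume := hη.memLp.sub hw2
    have m2 : MemLp (fun x => gradient η x - Dw x) 2 volume := hη.memLp_gradient.sub hDw2
    have h1' : ∫ x in U, ‖η x - w x‖ ^ 2 ≤ t ^ 2 :=
      integral_norm_sq_le_of_lintegral_enorm_sq_le (m1.restrict U).1 (by positivity)
        ((setLIntegral_le_lintegral _ _).trans h1)
    have h2' : ∫ x in U, ‖gradient η x - Dw x‖ ^ 2 ≤ t ^ 2 :=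
      integral_norm_sq_le_of_lintegral_enorm_sq_le (m2.restrict U).1 (by positivity)
        ((setLIntegral_le_lintegral _ _).trans h2)
    have i1 : Integrable (fun x => a x * w x + inner ℝ (Dw x) (G x)) (volume.restrict U) :=
      (ha.integrable_mul (hw2.restrict U)).add (integrable_inner_of_memLp (hDw2.restrict U) hG)
    have i2 : Integrable (fun x => a x * η x + fderiv ℝ η x (G x)) (volume.restrict U) := by
      have := (ha.integrable_mul (hη.memLp.restrict U)).add
        (integrable_inner_of_memLp (hη.memLp_gradient.restrict U) hG)
      refine this.congr (Eventually.of_forall fun x => ?_)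
      simp [inner_gradient_left]
    have e1 : ∫ x in U, (a x * w x + inner ℝ (Dw x) (G x)) =
        ∫ x in U, (a x * (w x - η x) + inner ℝ (Dw x - gradient η x) (G x)) := by
      rw [← sub_zero (∫ x in U, (a x * w x + inner ℝ (Dw x) (G x))), ← heq η hη,
        ← integral_sub i1 i2]
      refine integral_congr_ae (Eventually.of_forall fun x => ?_)
      simp only [inner_sub_left, inner_gradient_left]
      ring
    rw [e1]
    have ja := integrable_norm_sq ha
    have jG := integrable_norm_sq hG
    have jm1 := integrable_norm_sq (m1.restrict U)
    have jm2 := integrable_norm_sq (m2.restrict U)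
    calc |∫ x in U, (a x * (w x - η x) + inner ℝ (Dw x - gradient η x) (G x))|
        ≤ ∫ x in U, |a x * (w x - η x) + inner ℝ (Dw x - gradient η x) (G x)| :=
          abs_integral_le_integral_abs
      _ ≤ ∫ x in U, (t * (‖a x‖ ^ 2 + ‖G x‖ ^ 2) +
            t⁻¹ * (‖η x - w x‖ ^ 2 + ‖gradient η x - Dw x‖ ^ 2)) := by
          refine integral_mono_of_nonneg (Eventually.of_forall fun x => abs_nonneg _)
            (((ja.fun_add jG).const_mul t).add ((jm1.fun_add jm2).const_mul t⁻¹))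
            (Eventually.of_forall fun x => ?_)
          have q : ∀ p q : ℝ, p * q ≤ t * p ^ 2 + t⁻¹ * q ^ 2 := by
            intro p q
            have : 0 ≤ t⁻¹ * (t * p - q) ^ 2 := by positivity
            have e : t⁻¹ * (t * p - q) ^ 2 = t * p ^ 2 - 2 * (p * q) + t⁻¹ * q ^ 2 := by
              field_simp
              ring
            have : 0 ≤ t * p ^ 2 + t⁻¹ * q ^ 2 := by positivity
            nlinarith
          calc |a x * (w x - η x) + inner ℝ (Dw x - gradient η x) (G x)|
              ≤ |a x * (w x - η x)| + |inner ℝ (Dw x - gradient η x) (G x)| := abs_add_le _ _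
            _ ≤ ‖a x‖ * ‖η x - w x‖ + ‖G x‖ * ‖gradient η x - Dw x‖ := by
                rw [abs_mul, mul_comm ‖G x‖, norm_sub_rev (gradient η x), norm_sub_rev (η x)]
                exact add_le_add le_rfl (abs_real_inner_le_norm _ _)
            _ ≤ _ := by
                have := q ‖a x‖ ‖η x - w x‖
                have := q ‖G x‖ ‖gradient η x - Dw x‖
                linarith
      _ = t * M + t⁻¹ * ((∫ x in U, ‖η x - w x‖ ^ 2) + ∫ x in U, ‖gradient η x - Dw x‖ ^ 2) := by
          rw [integral_add ((ja.fun_add jG).const_mul t) ((jm1.fun_add jm2).const_mul t⁻¹),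
            integral_const_mul, integral_const_mul, integral_add ja jG, integral_add jm1 jm2]
      _ ≤ t * M + t⁻¹ * (t ^ 2 + t ^ 2) := by gcongr
      _ = t * (M + 2) := by field_simp; ring
  rw [← abs_nonpos_iff]
  refine le_of_forall_pos_le_add fun ε hε => ?_
  have := key (ε / (M + 2)) (by positivity)
  rwa [div_mul_cancel₀ _ (by positivity), ← zero_add ε] at this

/-! ### Poincaré inequality on convex sets -/

/-- The fundamental theorem of calculus along the segment from `x` to `y`, followed by
Cauchy–Schwarz in the parameter. -/
theorem enorm_sub_sq_le_lintegral_gradient {d : ℕ} {u : Euc d → ℝ} (hu : ContDiff ℝ 1 u)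
    (x y : Euc d) :
    ‖u y - u x‖ₑ ^ 2 ≤ ‖y - x‖ₑ ^ 2 *
      ∫⁻ t in Set.Ioc (0 : ℝ) 1, ‖gradient u (x + t • (y - x))‖ₑ ^ 2 := by
  have hline : ∀ t : ℝ, HasDerivAt (fun t : ℝ => x + t • (y - x)) (y - x) t := fun t => by
    simpa using ((hasDerivAt_id t).smul_const (y - x)).const_add x
  have hcl : Continuous fun t : ℝ => x + t • (y - x) := by fun_prop
  have hder : ∀ t : ℝ, HasDerivAt (fun t : ℝ => u (x + t • (y - x)))
      (fderiv ℝ u (x + t • (y - x)) (y - x)) t := fun t =>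
    ((hu.differentiable (by simp) _).hasFDerivAt).comp_hasDerivAt t (hline t)
  have hcont : Continuous fun t : ℝ => fderiv ℝ u (x + t • (y - x)) (y - x) :=
    ((hu.continuous_fderiv (by simp)).comp hcl).clm_apply continuous_const
  have hcg : Continuous fun t : ℝ => gradient u (x + t • (y - x)) :=
    hu.continuous_gradient_euc.comp hcl
  have hftc := intervalIntegral.integral_eq_sub_of_hasDerivAt (a := 0) (b := 1)
    (fun t _ => hder t) (hcont.intervalIntegrable _ _)
  simp only [one_smul, add_sub_cancel, zero_smul, add_zero] at hftc
  rw [← hftc, intervalIntegral.integral_of_le zero_le_one]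
  calc ‖∫ t in Set.Ioc (0 : ℝ) 1, fderiv ℝ u (x + t • (y - x)) (y - x)‖ₑ ^ 2
      ≤ (∫⁻ t in Set.Ioc (0 : ℝ) 1, ‖y - x‖ₑ * ‖gradient u (x + t • (y - x))‖ₑ) ^ 2 := by
        gcongr
        refine (enorm_integral_le_lintegral_enorm _).trans (lintegral_mono fun t => ?_)
        rw [← inner_gradient_left, mul_comm]
        simp only [← ofReal_norm, ← ENNReal.ofReal_mul (norm_nonneg _)]
        exact ENNReal.ofReal_le_ofReal (norm_inner_le_norm _ _)
    _ = ‖y - x‖ₑ ^ 2 * (∫⁻ t in Set.Ioc (0 : ℝ) 1, ‖gradient u (x + t • (y - x))‖ₑ) ^ 2 := by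
        rw [lintegral_const_mul _ hcg.enorm.measurable, mul_pow]
    _ ≤ _ := by
        gcongr
        refine (lintegral_sq_le_measure_univ_mul _ hcg.enorm.aemeasurable).trans_eq ?_
        simp

/-- By convexity the contraction `x ↦ (1 - t)x + ty` maps `S` into itself; the change of variables
costs `(1 - t)⁻ᵈ`, at most `2ᵈ` because `t ≤ 1/2`. -/
theorem setLIntegral_segment_le {d : ℕ} {S : Set (Euc d)} (hS : Convex ℝ S)
    (hSm : MeasurableSet S) {f : Euc d → ℝ≥0∞} (hf : Measurable f) {y : Euc d} (hy : y ∈ S)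
    {t : ℝ} (ht0 : 0 ≤ t) (ht : t ≤ 1 / 2) :
    ∫⁻ x in S, f (x + t • (y - x)) ≤ 2 ^ d * ∫⁻ x in S, f x := by
  have hfs : Measurable (S.indicator f) := hf.indicator hSm
  have ht1 : (1 - t) ≠ 0 := by linarith
  calc ∫⁻ x in S, f (x + t • (y - x))
      ≤ ∫⁻ x in S, S.indicator f ((1 - t) • x + t • y) := by
        refine setLIntegral_mono' hSm fun x hx => ?_
        have e : x + t • (y - x) = (1 - t) • x + t • y := by module
        rw [e, Set.indicator_of_mem (hS hx hy (by linarith) ht0 (by ring))]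
    _ ≤ ∫⁻ x, S.indicator f ((1 - t) • x + t • y) := setLIntegral_le_lintegral _ _
    _ = ∫⁻ x, S.indicator f (x + t • y) ∂(Measure.map ((1 - t) • ·) volume) := by
        rw [lintegral_map (f := fun x => S.indicator f (x + t • y))
          (hfs.comp (measurable_add_const _)) (measurable_const_smul _)]
    _ = ENNReal.ofReal |((1 - t) ^ d)⁻¹| * ∫⁻ x in S, f x := by
        rw [Measure.map_addHaar_smul _ ht1, lintegral_smul_measure,
          lintegral_add_right_eq_self, lintegral_indicator hSm, finrank_euclideanSpace_fin]
        rfl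
    _ ≤ _ := by
        gcongr
        rw [abs_of_nonneg (inv_nonneg.2 (pow_nonneg (by linarith) _)), ← inv_pow,
          ENNReal.ofReal_pow (inv_nonneg.2 (by linarith))]
        gcongr
        refine ENNReal.ofReal_le_of_le_toReal ?_
        rw [ENNReal.toReal_ofNat]
        exact inv_le_of_inv_le₀ (by norm_num) (by linarith)

/-- Tonelli, used to bring the segment parameter outside the double integral over the endpoints. -/
theorem lintegral_rotate {X Y Z : Type*} [MeasurableSpace X] [MeasurableSpace Y]
    [MeasurableSpace Z] (μ : Measure X) (ν : Measure Y) (τ : Measure Z) [SFinite μ] [SFinite ν]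
    [SFinite τ] (c : ℝ≥0∞) {F : (X × Y) × Z → ℝ≥0∞} (hF : Measurable F) :
    ∫⁻ x, ∫⁻ y, c * ∫⁻ z, F ((x, y), z) ∂τ ∂ν ∂μ = c * ∫⁻ z, ∫⁻ x, ∫⁻ y, F ((x, y), z) ∂ν ∂μ ∂τ := by
  have h2 : Measurable fun p : X × Y => ∫⁻ z, F (p, z) ∂τ := hF.lintegral_prod_right'
  have h1 : Measurable fun x => ∫⁻ y, ∫⁻ z, F ((x, y), z) ∂τ ∂ν := h2.lintegral_prod_right'
  calc ∫⁻ x, ∫⁻ y, c * ∫⁻ z, F ((x, y), z) ∂τ ∂ν ∂μ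
      = ∫⁻ x, c * ∫⁻ y, ∫⁻ z, F ((x, y), z) ∂τ ∂ν ∂μ :=
        lintegral_congr fun x =>
          lintegral_const_mul _ (h2.comp (measurable_const.prodMk measurable_id))
    _ = c * ∫⁻ x, ∫⁻ y, ∫⁻ z, F ((x, y), z) ∂τ ∂ν ∂μ := lintegral_const_mul _ h1
    _ = c * ∫⁻ x, ∫⁻ z, ∫⁻ y, F ((x, y), z) ∂ν ∂τ ∂μ := by
        congr 1
        refine lintegral_congr fun x => lintegral_lintegral_swap ?_
        exact (hF.comp (f := fun p : Y × Z => ((x, p.1), p.2)) (by fun_prop)).aemeasurable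
    _ = c * ∫⁻ z, ∫⁻ x, ∫⁻ y, F ((x, y), z) ∂ν ∂μ ∂τ := by
        congr 1
        refine lintegral_lintegral_swap (Measurable.aemeasurable ?_)
        have h3 : Measurable fun p : (X × Z) × Y => F ((p.1.1, p.2), p.1.2) :=
          hF.comp (by fun_prop)
        exact h3.lintegral_prod_right'

/-- The Poincaré inequality on a bounded convex set, in double integral form. -/
theorem lintegral_lintegral_sub_sq_le_of_contDiff {d : ℕ} {S : Set (Euc d)} (hS : Convex ℝ S)
    (hSm : MeasurableSet S) {D : ℝ≥0∞} (hD : ∀ x ∈ S, ∀ y ∈ S, ‖y - x‖ₑ ≤ D) {u : Euc d → ℝ}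
    (hu : ContDiff ℝ 1 u) :
    ∫⁻ x in S, ∫⁻ y in S, ‖u y - u x‖ₑ ^ 2 ≤
      D ^ 2 * (2 ^ d * volume S) * ∫⁻ x in S, ‖gradient u x‖ₑ ^ 2 := by
  set f : Euc d → ℝ≥0∞ := fun x => ‖gradient u x‖ₑ ^ 2 with hf
  have hfc : Continuous f := (ENNReal.continuous_pow 2).comp hu.continuous_gradient_euc.enorm
  have half : ∀ t : ℝ, 0 ≤ t → t ≤ 1 / 2 → ∫⁻ y in S, ∫⁻ x in S, f (x + t • (y - x)) ≤
      2 ^ d * volume S * ∫⁻ x in S, f x := by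
    intro t ht0 ht
    calc ∫⁻ y in S, ∫⁻ x in S, f (x + t • (y - x))
        ≤ ∫⁻ y in S, 2 ^ d * ∫⁻ x in S, f x :=
          setLIntegral_mono' hSm fun y hy =>
            setLIntegral_segment_le hS hSm hfc.measurable hy ht0 ht
      _ = _ := by rw [setLIntegral_const]; ring
  have hswap : ∀ t : ℝ, ∫⁻ x in S, ∫⁻ y in S, f (x + t • (y - x)) =
      ∫⁻ y in S, ∫⁻ x in S, f (x + t • (y - x)) := fun t =>
    lintegral_lintegral_swap (hfc.comp (by fun_prop)).measurable.aemeasurable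
  -- Exchanging the endpoints `x` and `y` replaces `t` by `1 - t`, so the factor `(1 - t)⁻ᵈ` is only
  -- ever needed for `t ≤ 1/2`.
  have all : ∀ t ∈ Set.Ioc (0 : ℝ) 1, ∫⁻ x in S, ∫⁻ y in S, f (x + t • (y - x)) ≤
      2 ^ d * volume S * ∫⁻ x in S, f x := by
    intro t ht
    by_cases h : t ≤ 1 / 2
    · rw [hswap]
      exact half t ht.1.le h
    · refine le_trans (le_of_eq ?_) (half (1 - t) (by linarith [ht.2]) (by linarith))
      refine lintegral_congr fun x => lintegral_congr fun y => ?_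
      congr 1
      module
  calc ∫⁻ x in S, ∫⁻ y in S, ‖u y - u x‖ₑ ^ 2
      ≤ ∫⁻ x in S, ∫⁻ y in S, D ^ 2 * ∫⁻ t in Set.Ioc (0 : ℝ) 1, f (x + t • (y - x)) := by
        refine setLIntegral_mono' hSm fun x hx => setLIntegral_mono' hSm fun y hy => ?_
        refine (enorm_sub_sq_le_lintegral_gradient hu x y).trans ?_
        gcongr
        exact hD x hx y hy
    _ = D ^ 2 * ∫⁻ t in Set.Ioc (0 : ℝ) 1, ∫⁻ x in S, ∫⁻ y in S, f (x + t • (y - x)) :=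
        lintegral_rotate _ _ _ _ (F := fun p => f (p.1.1 + p.2 • (p.1.2 - p.1.1)))
          (Continuous.measurable (hfc.comp (by fun_prop)))
    _ ≤ D ^ 2 * ∫⁻ t in Set.Ioc (0 : ℝ) 1, 2 ^ d * volume S * ∫⁻ x in S, f x := by
        gcongr D ^ 2 * ?_
        exact setLIntegral_mono' measurableSet_Ioc all
    _ = _ := by
        rw [setLIntegral_const, Real.volume_Ioc]
        simp [mul_assoc]

theorem ENNReal.add_sq_le_four_mul (a b : ℝ≥0∞) : (a + b) ^ 2 ≤ 4 * (a ^ 2 + b ^ 2) := by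
  rcases le_total a b with h | h
  · calc (a + b) ^ 2 ≤ (b + b) ^ 2 := by gcongr
      _ = 4 * b ^ 2 := by ring
      _ ≤ _ := by gcongr; exact le_add_self
  · calc (a + b) ^ 2 ≤ (a + a) ^ 2 := by gcongr
      _ = 4 * a ^ 2 := by ring
      _ ≤ _ := by gcongr; exact le_self_add

theorem enorm_add_sq_le {F : Type*} [NormedAddCommGroup F] (x y : F) :
    ‖x + y‖ₑ ^ 2 ≤ 4 * (‖x‖ₑ ^ 2 + ‖y‖ₑ ^ 2) :=
  (pow_le_pow_left' (enorm_add_le x y) 2).trans (ENNReal.add_sq_le_four_mul _ _)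

/-- The Poincaré inequality on a bounded convex set for compactly supported `H¹` functions. -/
theorem MemH1.lintegral_lintegral_sub_sq_le_of_support {d : ℕ} {S K : Set (Euc d)}
    (hS : Convex ℝ S) (hSm : MeasurableSet S) (hSv : volume S ≠ ⊤) {D : ℝ≥0∞} (hDt : D ≠ ⊤)
    (hD : ∀ x ∈ S, ∀ y ∈ S, ‖y - x‖ₑ ≤ D) {w : Euc d → ℝ} {Dw : Euc d → Euc d}
    (hw : MemH1 Set.univ w Dw) (hK : IsCompact K) (hwK : ∀ x ∉ K, w x = 0) :
    ∫⁻ x in S, ∫⁻ y in S, ‖w y - w x‖ₑ ^ 2 ≤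
      64 * (D ^ 2 * (2 ^ d * volume S)) * ∫⁻ x in S, ‖Dw x‖ₑ ^ 2 := by
  have hw2 : MemLp w 2 volume := by simpa using hw.memLp
  have hDw2 : MemLp Dw 2 volume := by simpa using hw.memLp_grad
  set P := D ^ 2 * (2 ^ d * volume S) with hP
  set V := volume S with hV
  have hPt : P ≠ ⊤ := by
    refine ENNReal.mul_ne_top (ENNReal.pow_ne_top hDt) (ENNReal.mul_ne_top ?_ hSv)
    exact ENNReal.pow_ne_top (by simp)
  -- `M` collects the coefficients of the approximation error `ε` in the final estimate: `16 * 2V`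
  -- from replacing `w` by `η`, and `16 * 4P` from the gradients.
  set M := 32 * V + 64 * P with hM
  have hMt : M + 1 ≠ ⊤ := by finiteness
  refine ENNReal.le_of_forall_pos_le_add fun δ hδ _ => ?_
  set ε : ℝ≥0∞ := δ / (M + 1) with hε
  have hε0 : ε ≠ 0 := ENNReal.div_ne_zero.2 ⟨by simpa using hδ.ne', hMt⟩
  have hεM : M * ε ≤ δ := by
    calc M * ε ≤ (M + 1) * ε := by gcongr; exact le_self_add
      _ = δ := ENNReal.mul_div_cancel (by simp) hMt
  obtain ⟨η, hη, h1, h2⟩ := hw.exists_testFunction_approx isOpen_univ hK (Set.subset_univ _) hwK hε0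
  have hP' := lintegral_lintegral_sub_sq_le_of_contDiff hS hSm hD
    (hη.contDiff.of_le (by norm_cast) : ContDiff ℝ 1 η)
  have hA : AEMeasurable (fun x => ‖η x - w x‖ₑ ^ 2) (volume.restrict S) :=
    ((hη.memLp.sub hw2).1.restrict.enorm.pow_const 2)
  have hB : Measurable fun p : Euc d × Euc d => ‖η p.2 - η p.1‖ₑ ^ 2 := by
    have := hη.contDiff.continuous
    exact Continuous.measurable (by fun_prop)
  have hBx : ∀ x, Measurable fun y => ‖η y - η x‖ₑ ^ 2 := fun x =>
    hB.comp (measurable_const.prodMk measurable_id)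
  have hBi : Measurable fun x => ∫⁻ y in S, ‖η y - η x‖ₑ ^ 2 := hB.lintegral_prod_right'
  have hAε : ∫⁻ x in S, ‖η x - w x‖ₑ ^ 2 ≤ ε := (setLIntegral_le_lintegral _ _).trans h1
  have hGε : ∫⁻ x in S, ‖gradient η x‖ₑ ^ 2 ≤ 4 * (ε + ∫⁻ x in S, ‖Dw x‖ₑ ^ 2) := by
    calc ∫⁻ x in S, ‖gradient η x‖ₑ ^ 2
        ≤ ∫⁻ x in S, 4 * (‖gradient η x - Dw x‖ₑ ^ 2 + ‖Dw x‖ₑ ^ 2) := by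
          refine lintegral_mono fun x => ?_
          have := enorm_add_sq_le (gradient η x - Dw x) (Dw x)
          rwa [sub_add_cancel] at this
      _ = 4 * ((∫⁻ x in S, ‖gradient η x - Dw x‖ₑ ^ 2) + ∫⁻ x in S, ‖Dw x‖ₑ ^ 2) := by
          rw [lintegral_const_mul' _ _ (by simp), lintegral_add_right']
          exact hDw2.1.restrict.enorm.pow_const 2
      _ ≤ _ := by
          gcongr
          exact (setLIntegral_le_lintegral _ _).trans h2
  calc ∫⁻ x in S, ∫⁻ y in S, ‖w y - w x‖ₑ ^ 2
      ≤ ∫⁻ x in S, ∫⁻ y in S, 16 * (‖η y - w y‖ₑ ^ 2 + (‖η y - η x‖ₑ ^ 2 + ‖η x - w x‖ₑ ^ 2)) := by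
        refine lintegral_mono fun x => lintegral_mono fun y => ?_
        have a1 := enorm_add_sq_le (w y - η y) ((η y - η x) + (η x - w x))
        have a2 := enorm_add_sq_le (η y - η x) (η x - w x)
        rw [show (w y - η y) + ((η y - η x) + (η x - w x)) = w y - w x by ring,
          enorm_sub_rev (w y) (η y)] at a1
        refine a1.trans ?_
        calc 4 * (‖η y - w y‖ₑ ^ 2 + ‖η y - η x + (η x - w x)‖ₑ ^ 2)
            ≤ 4 * (4 * ‖η y - w y‖ₑ ^ 2 + 4 * (‖η y - η x‖ₑ ^ 2 + ‖η x - w x‖ₑ ^ 2)) := by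
              gcongr
              exact le_mul_of_one_le_left' (by norm_num)
          _ = _ := by ring
    _ = ∫⁻ x in S, 16 * ((∫⁻ y in S, ‖η y - w y‖ₑ ^ 2) +
          ((∫⁻ y in S, ‖η y - η x‖ₑ ^ 2) + ‖η x - w x‖ₑ ^ 2 * V)) := by
        refine lintegral_congr fun x => ?_
        rw [lintegral_const_mul' _ _ (by simp), lintegral_add_left' hA,
          lintegral_add_left (hBx x), setLIntegral_const]
    _ = 16 * ((∫⁻ y in S, ‖η y - w y‖ₑ ^ 2) * V + ((∫⁻ x in S, ∫⁻ y in S, ‖η y - η x‖ₑ ^ 2) +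
          (∫⁻ x in S, ‖η x - w x‖ₑ ^ 2) * V)) := by
        rw [lintegral_const_mul' _ _ (by simp), lintegral_add_left measurable_const,
          setLIntegral_const, lintegral_add_left hBi, lintegral_mul_const' _ _ hSv]
    _ ≤ 16 * (ε * V + (P * (4 * (ε + ∫⁻ x in S, ‖Dw x‖ₑ ^ 2)) + ε * V)) := by
        gcongr
        exact hP'.trans (by gcongr)
    _ = 64 * P * (∫⁻ x in S, ‖Dw x‖ₑ ^ 2) + M * ε := by rw [hM]; ring
    _ ≤ _ := by gcongr

/-- The Poincaré inequality on a convex set inside a smaller ball. -/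
theorem MemH1.lintegral_lintegral_sub_sq_le {d : ℕ} {S : Set (Euc d)} {ρ P : ℝ} (hρ : 0 < ρ)
    (hρP : ρ < P) (hS : Convex ℝ S) (hSm : MeasurableSet S) (hSρ : S ⊆ originBall d ρ) {D : ℝ≥0∞}
    (hDt : D ≠ ⊤) (hD : ∀ x ∈ S, ∀ y ∈ S, ‖y - x‖ₑ ≤ D) {v : Euc d → ℝ} {Dv : Euc d → Euc d}
    (hv : MemH1 (originBall d P) v Dv) :
    ∫⁻ x in S, ∫⁻ y in S, ‖v y - v x‖ₑ ^ 2 ≤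
      64 * (D ^ 2 * (2 ^ d * volume S)) * ∫⁻ x in S, ‖Dv x‖ₑ ^ 2 := by
  -- `χ v` is globally `H¹` with compact support and has the same values and gradient as `v` on `S`,
  -- since `χ = 1` on the open ball `B_ρ` containing `S`.
  let χ : ContDiffBump (0 : Euc d) := ⟨ρ, (ρ + P) / 2, hρ, by linarith⟩
  have hχ : IsTestFunction (originBall d P) χ := by
    refine ⟨χ.contDiff, χ.hasCompactSupport, ?_⟩
    rw [χ.tsupport_eq]
    exact Metric.closedBall_subset_ball (by change (ρ + P) / 2 < P; linarith)
  have hw := hv.testFunction_mul measurableSet_ball hχ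
  have hSv : volume S ≠ ⊤ := ((measure_mono hSρ).trans_lt measure_ball_lt_top).ne
  have h := hw.lintegral_lintegral_sub_sq_le_of_support hS hSm hSv hDt hD
    hχ.hasCompactSupport.isCompact fun x hx => by
      rw [image_eq_zero_of_notMem_tsupport hx, zero_mul]
  have e1 : ∀ x ∈ S, χ x = 1 := fun x hx =>
    χ.one_of_mem_closedBall (Metric.ball_subset_closedBall (hSρ hx))
  have e2 : ∀ x ∈ S, gradient χ x = 0 := by
    intro x hx
    have : (χ : Euc d → ℝ) =ᶠ[nhds x] fun _ => 1 :=
      Filter.eventuallyEq_of_mem (Metric.isOpen_ball.mem_nhds (hSρ hx)) fun y hy =>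
        χ.one_of_mem_closedBall (Metric.ball_subset_closedBall hy)
    rw [this.gradient_eq, gradient_fun_const]
  refine le_trans (le_of_eq ?_) (h.trans (le_of_eq ?_))
  · refine setLIntegral_congr_fun hSm fun x hx => setLIntegral_congr_fun hSm fun y hy => ?_
    simp [e1 x hx, e1 y hy]
  · congr 1
    refine setLIntegral_congr_fun hSm fun x hx => ?_
    simp [e1 x hx, e2 x hx]

/-! ### Poincaré inequality on an annulus through overlapping caps -/

theorem measure_mul_enorm_setAverage_sq_le {d : ℕ} {I : Set (Euc d)} (hI0 : volume I ≠ 0)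
    (hIt : volume I ≠ ⊤) {h : Euc d → ℝ} (hh : AEMeasurable h (volume.restrict I)) :
    volume I * ‖⨍ y in I, h y‖ₑ ^ 2 ≤ ∫⁻ y in I, ‖h y‖ₑ ^ 2 := by
  have h1 : volume I * ‖⨍ y in I, h y‖ₑ ≤ ∫⁻ y in I, ‖h y‖ₑ := by
    have e : (volume.real I) • ⨍ y in I, h y = ∫ y in I, h y := by
      rw [setAverage_eq, smul_smul, mul_inv_cancel₀, one_smul]
      exact (ENNReal.toReal_pos hI0 hIt).ne'
    have h2 : ‖(volume.real I) • ⨍ y in I, h y‖ₑ = volume I * ‖⨍ y in I, h y‖ₑ := by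
      rw [enorm_smul, Real.enorm_of_nonneg measureReal_nonneg, ofReal_measureReal hIt]
    rw [← h2, e]
    exact enorm_integral_le_lintegral_enorm _
  have h3 : volume I * (volume I * ‖⨍ y in I, h y‖ₑ ^ 2) ≤ volume I * ∫⁻ y in I, ‖h y‖ₑ ^ 2 := by
    calc volume I * (volume I * ‖⨍ y in I, h y‖ₑ ^ 2) = (volume I * ‖⨍ y in I, h y‖ₑ) ^ 2 := by ring
      _ ≤ (∫⁻ y in I, ‖h y‖ₑ) ^ 2 := by gcongr
      _ ≤ _ := (lintegral_sq_le_measure_univ_mul _ hh.enorm).trans_eq (by simp)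
  exact (ENNReal.mul_le_mul_iff_right hI0 hIt).1 h3

/-- Jensen for the mean over `y ∈ I` of `u y - u x`, then enlarging the domain of `y` to `S`. The
mean is taken over the small set `I`, not over `S`, so that the constant can be shared by several
caps. -/
theorem measure_mul_lintegral_sub_setAverage_sq_le {d : ℕ} {I S : Set (Euc d)}
    (hI0 : volume I ≠ 0) (hIt : volume I ≠ ⊤) (hIS : I ⊆ S) {u : Euc d → ℝ}
    (hu : IntegrableOn u I) :
    volume I * ∫⁻ x in S, ‖u x - ⨍ y in I, u y‖ₑ ^ 2 ≤
      ∫⁻ x in S, ∫⁻ y in S, ‖u y - u x‖ₑ ^ 2 := by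
  rw [← lintegral_const_mul' _ _ hIt]
  refine lintegral_mono fun x => ?_
  have hc : IntegrableOn (fun _ : Euc d => u x) I := integrableOn_const hIt
  have e : ⨍ y in I, (u y - u x) = (⨍ y in I, u y) - u x := by
    simp only [setAverage_eq]
    rw [integral_sub hu hc, smul_sub, setIntegral_const, smul_smul, inv_mul_cancel₀, one_smul]
    exact (ENNReal.toReal_pos hI0 hIt).ne'
  have h := measure_mul_enorm_setAverage_sq_le hI0 hIt (hu.sub hc).aemeasurable
  have e' : ⨍ y in I, (u - (fun _ => u x : Euc d → ℝ)) y = (⨍ y in I, u y) - u x := e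
  rw [e', enorm_sub_rev] at h
  exact h.trans (lintegral_mono_set hIS)

/-- Transfers closeness to `c` from `S₁` to `S₂`: write `u x - c = (u x - u y) + (u y - c)` and
integrate over `y` in the common part `I`. -/
theorem measure_mul_lintegral_sub_sq_le_of_subset_inter {d : ℕ} {I S₁ S₂ : Set (Euc d)}
    (h1 : I ⊆ S₁) (h2 : I ⊆ S₂) (hIt : volume I ≠ ⊤) {u : Euc d → ℝ}
    (hu : AEMeasurable u (volume.restrict S₁)) (c : ℝ) :
    volume I * ∫⁻ x in S₂, ‖u x - c‖ₑ ^ 2 ≤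
      4 * ((∫⁻ x in S₂, ∫⁻ y in S₂, ‖u y - u x‖ₑ ^ 2) +
        volume S₂ * ∫⁻ x in S₁, ‖u x - c‖ₑ ^ 2) := by
  have hm : AEMeasurable (fun y => ‖u y - c‖ₑ ^ 2) (volume.restrict I) :=
    ((hu.mono_measure (Measure.restrict_mono_set _ h1)).sub_const c).enorm.pow_const 2
  calc volume I * ∫⁻ x in S₂, ‖u x - c‖ₑ ^ 2
      = ∫⁻ x in S₂, ∫⁻ y in I, ‖u x - c‖ₑ ^ 2 := by
        simp_rw [setLIntegral_const]
        rw [lintegral_mul_const' _ _ hIt, mul_comm]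
    _ ≤ ∫⁻ x in S₂, ∫⁻ y in I, 4 * (‖u y - u x‖ₑ ^ 2 + ‖u y - c‖ₑ ^ 2) := by
        refine lintegral_mono fun x => lintegral_mono fun y => ?_
        have := enorm_add_sq_le (u x - u y) (u y - c)
        rwa [sub_add_sub_cancel, enorm_sub_rev (u x) (u y)] at this
    _ = ∫⁻ x in S₂, 4 * ((∫⁻ y in I, ‖u y - u x‖ₑ ^ 2) + ∫⁻ y in I, ‖u y - c‖ₑ ^ 2) := by
        refine lintegral_congr fun x => ?_
        rw [lintegral_const_mul' _ _ (by simp), lintegral_add_right' _ hm]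
    _ = 4 * ((∫⁻ x in S₂, ∫⁻ y in I, ‖u y - u x‖ₑ ^ 2) +
          volume S₂ * ∫⁻ y in I, ‖u y - c‖ₑ ^ 2) := by
        rw [lintegral_const_mul' _ _ (by simp), lintegral_add_right _ measurable_const,
          setLIntegral_const, mul_comm (volume S₂)]
    _ ≤ _ := by gcongr

/-- The convex cap cut out of the ball of radius `ρ` by the half space `r < ⟪e, x⟫`. -/
def ballCap {d : ℕ} (ρ r : ℝ) (e : Euc d) : Set (Euc d) :=
  originBall d ρ ∩ {x | r < inner ℝ e x}

theorem convex_ballCap {d : ℕ} (ρ r : ℝ) (e : Euc d) : Convex ℝ (ballCap ρ r e) :=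
  (convex_ball _ _).inter (convex_halfSpace_gt (innerₛₗ ℝ e).isLinear r)

theorem measurableSet_ballCap {d : ℕ} (ρ r : ℝ) (e : Euc d) : MeasurableSet (ballCap ρ r e) :=
  measurableSet_ball.inter
    (isOpen_lt continuous_const (continuous_const.inner continuous_id)).measurableSet

theorem ballCap_subset_annulus {d : ℕ} {ρ r P : ℝ} (hP : ρ ≤ P) {e : Euc d} (he : ‖e‖ = 1) :
    ballCap ρ r e ⊆ originBall d P \ originBall d r := by
  rintro x ⟨hx, hx2⟩
  refine ⟨Metric.ball_subset_ball hP hx, fun h => ?_⟩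
  have h1 := real_inner_le_norm e x
  have h2 : ‖x‖ < r := mem_ball_zero_iff.1 h
  rw [he, one_mul] at h1
  have h3 : r < inner ℝ e x := hx2
  linarith

theorem ball_subset_ballCap {d : ℕ} {ρ r : ℝ} (hr : 0 < r) (hρ : 8 * r ≤ ρ) {e z : Euc d}
    (he : ‖e‖ = 1) (hz : ‖z‖ ≤ 4 * r) (hez : inner ℝ e z = 2 * r) :
    Metric.ball z (r / 2) ⊆ ballCap ρ r e := by
  intro x hx
  have hx' : ‖x - z‖ < r / 2 := mem_ball_iff_norm.1 hx
  have h1 : ‖x‖ ≤ ‖x - z‖ + ‖z‖ := by simpa using norm_add_le (x - z) z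
  have h2 := abs_le.1 (abs_real_inner_le_norm e (x - z))
  rw [he, one_mul, inner_sub_right, hez] at h2
  exact ⟨mem_ball_zero_iff.2 (by linarith), show r < inner ℝ e x by linarith⟩

/-- The coordinate direction `± e_i`. -/
noncomputable def signedBasis {d : ℕ} (p : Fin d × Bool) : Euc d :=
  EuclideanSpace.single p.1 (if p.2 then 1 else -1)

theorem norm_signedBasis {d : ℕ} (p : Fin d × Bool) : ‖signedBasis p‖ = 1 := by
  unfold signedBasis; split_ifs <;> simp

theorem inner_signedBasis_of_ne {d : ℕ} {p q : Fin d × Bool} (h : p.1 ≠ q.1) :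
    inner ℝ (signedBasis p) (signedBasis q) = 0 := by
  simp [signedBasis, EuclideanSpace.inner_single_left, h]

/-- A point of the ball in no cap has all coordinates at most `r` in absolute value, so its norm is
at most `√d r`, strictly less than `d r` because `d ≥ 2`. -/
theorem annulus_subset_iUnion_ballCap {d : ℕ} (hd : 2 ≤ d) {ρ r : ℝ} (hr : 0 < r) :
    originBall d ρ \ originBall d (d * r) ⊆ ⋃ p : Fin d × Bool, ballCap ρ r (signedBasis p) := by
  rintro x ⟨hx, hx2⟩
  by_contra hc
  simp only [Set.mem_iUnion, not_exists, ballCap, Set.mem_inter_iff, not_and, Set.mem_ofPred_eq,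
    not_lt] at hc
  have hi : ∀ i, |x i| ≤ r := by
    intro i
    have h1 := hc (i, true) hx
    have h2 := hc (i, false) hx
    simp [signedBasis, EuclideanSpace.inner_single_left] at h1 h2
    exact abs_le.2 ⟨by linarith, h1⟩
  have hn : (d * r) ≤ ‖x‖ := by simpa using hx2
  have hs : ‖x‖ ^ 2 ≤ d * r ^ 2 := by
    rw [EuclideanSpace.real_norm_sq_eq]
    calc ∑ i, x i ^ 2 ≤ ∑ _i : Fin d, r ^ 2 :=
          Finset.sum_le_sum fun i _ => sq_le_sq' (abs_le.1 (hi i)).1 (abs_le.1 (hi i)).2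
      _ = d * r ^ 2 := by simp
  have hd' : (2 : ℝ) ≤ d := by exact_mod_cast hd
  have h3 : (d * r) ^ 2 ≤ ‖x‖ ^ 2 := by gcongr
  have h4 : 0 < r ^ 2 := by positivity
  nlinarith

/-- The Poincaré inequality on an annulus, together with a bound on the subtracted constant. -/
theorem exists_poincare_annulus {d : ℕ} (hd : 2 ≤ d) :
    ∃ C : ℝ≥0∞, C ≠ ⊤ ∧ ∀ r : ℝ, 0 < r → ∀ (v : Euc d → ℝ) (Dv : Euc d → Euc d),
      MemH1 (originBall d (5 * d * r)) v Dv → ∃ c : ℝ,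
        volume (originBall d (5 * d * r)) * ‖c‖ₑ ^ 2 ≤
          C * ∫⁻ x in originBall d (5 * d * r) \ originBall d r, ‖v x‖ₑ ^ 2 ∧
        ∫⁻ x in originBall d (4 * d * r) \ originBall d (d * r), ‖v x - c‖ₑ ^ 2 ≤
          C * (ENNReal.ofReal r ^ 2 *
            ∫⁻ x in originBall d (5 * d * r) \ originBall d r, ‖Dv x‖ₑ ^ 2) := by
  have hd' : (2 : ℝ) ≤ d := by exact_mod_cast hd
  -- `κ` is the volume ratio of `B_{5dr}` to a ball of radius `r/2`. `C₀` is the Poincaré constant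
  -- of a cap (diameter at most `8dr`) after division by the volume of the small ball; `C₁` and `C₂`
  -- arise after passing to a second and a third cap.
  set κ : ℝ≥0∞ := ENNReal.ofReal (10 * d) ^ d with hκ
  set C₀ : ℝ≥0∞ := 64 * ENNReal.ofReal (8 * d) ^ 2 * 2 ^ d * κ with hC₀
  set C₁ : ℝ≥0∞ := 4 * (C₀ + κ * C₀) with hC₁
  set C₂ : ℝ≥0∞ := 4 * (C₀ + κ * C₁) with hC₂
  set N : ℝ≥0∞ := (Fintype.card (Fin d × Bool) : ℝ≥0∞) with hN
  have hκt : κ ≠ ⊤ := by finiteness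
  have hC₀t : C₀ ≠ ⊤ := by finiteness
  have hC₁t : C₁ ≠ ⊤ := by finiteness
  have hC₂t : C₂ ≠ ⊤ := by finiteness
  have hNt : N ≠ ⊤ := by finiteness
  refine ⟨κ + N * (C₀ + C₁ + C₂), by finiteness, fun r hr v Dv hv => ?_⟩
  set ρ : ℝ := 4 * d * r with hρ
  set A := originBall d (5 * d * r) \ originBall d r with hA
  set X := ENNReal.ofReal r ^ 2 * ∫⁻ x in A, ‖Dv x‖ₑ ^ 2 with hX
  have hdr : 2 * r ≤ d * r := by gcongr
  have h8 : 8 * r ≤ ρ := by rw [hρ]; nlinarith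
  have hρP : ρ < 5 * d * r := by rw [hρ]; nlinarith
  have hβ : ∀ z : Euc d, volume (Metric.ball z (r / 2)) = volume (originBall d (r / 2)) :=
    fun z => Measure.addHaar_ball_center _ _ _
  set β := volume (originBall d (r / 2)) with hβdef
  have hβ0 : β ≠ 0 := (Metric.measure_ball_pos _ _ (by positivity)).ne'
  have hβt : β ≠ ⊤ := measure_ball_lt_top.ne
  have hvol : volume (originBall d (5 * d * r)) = κ * β := by
    have := Measure.addHaar_ball_mul_of_pos (volume : Measure (Euc d)) 0
      (r := 10 * d) (by positivity) (r / 2)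
    rw [show 10 * (d : ℝ) * (r / 2) = 5 * d * r by ring, finrank_euclideanSpace_fin,
      ENNReal.ofReal_pow (by positivity)] at this
    exact this
  have hcapA : ∀ p, ballCap ρ r (signedBasis p) ⊆ A := fun p =>
    ballCap_subset_annulus hρP.le (norm_signedBasis p)
  have hcapV : ∀ p : Fin d × Bool, volume (ballCap ρ r (signedBasis p)) ≤ κ * β := fun p =>
    hvol ▸ measure_mono ((hcapA p).trans Set.sdiff_subset)
  have hpoin : ∀ p : Fin d × Bool, ∫⁻ x in ballCap ρ r (signedBasis p),
      ∫⁻ y in ballCap ρ r (signedBasis p), ‖v y - v x‖ₑ ^ 2 ≤ β * (C₀ * X) := by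
    intro p
    have h := hv.lintegral_lintegral_sub_sq_le (ρ := ρ) (by positivity) hρP
      (convex_ballCap ρ r (signedBasis p)) (measurableSet_ballCap _ _ _) Set.inter_subset_left
      (D := ENNReal.ofReal (8 * d) * ENNReal.ofReal r) (by finiteness) (fun x hx y hy => by
        rw [← ENNReal.ofReal_mul (by positivity), ← ofReal_norm]
        refine ENNReal.ofReal_le_ofReal ((norm_sub_le y x).trans ?_)
        have h1 : ‖x‖ < ρ := mem_ball_zero_iff.1 hx.1
        have h2 : ‖y‖ < ρ := mem_ball_zero_iff.1 hy.1
        rw [hρ] at h1 h2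
        linarith)
    refine h.trans ?_
    calc 64 * ((ENNReal.ofReal (8 * d) * ENNReal.ofReal r) ^ 2 *
          (2 ^ d * volume (ballCap ρ r (signedBasis p)))) *
          ∫⁻ x in ballCap ρ r (signedBasis p), ‖Dv x‖ₑ ^ 2
        ≤ 64 * ((ENNReal.ofReal (8 * d) * ENNReal.ofReal r) ^ 2 * (2 ^ d * (κ * β))) *
          ∫⁻ x in A, ‖Dv x‖ₑ ^ 2 := by
          gcongr
          · exact hcapV p
          · exact hcapA p
      _ = β * (C₀ * X) := by rw [hC₀, hX]; ring
  have hvm : AEMeasurable v (volume.restrict (originBall d (5 * d * r))) :=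
    hv.memLp.1.aemeasurable
  have step : ∀ (p q : Fin d × Bool), p.1 ≠ q.1 → ∀ (c : ℝ) (C : ℝ≥0∞),
      ∫⁻ x in ballCap ρ r (signedBasis p), ‖v x - c‖ₑ ^ 2 ≤ C * X →
      ∫⁻ x in ballCap ρ r (signedBasis q), ‖v x - c‖ₑ ^ 2 ≤ 4 * (C₀ + κ * C) * X := by
    intro p q hpq c C hC
    -- The ball of radius `r/2` about `z` lies in both caps, because `z` has inner product `2r` with
    -- each of the two directions.
    set z : Euc d := (2 * r) • signedBasis p + (2 * r) • signedBasis q with hz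
    have hzn : ‖z‖ ≤ 4 * r := by
      refine (norm_add_le _ _).trans ?_
      rw [norm_smul, norm_smul, norm_signedBasis, norm_signedBasis, Real.norm_of_nonneg (by positivity)]
      linarith
    have h1 : inner ℝ (signedBasis p) z = 2 * r := by
      rw [hz, inner_add_right, inner_smul_right, inner_smul_right, inner_signedBasis_of_ne hpq,
        real_inner_self_eq_norm_sq, norm_signedBasis]
      ring
    have h2 : inner ℝ (signedBasis q) z = 2 * r := by
      rw [hz, inner_add_right, inner_smul_right, inner_smul_right,
        inner_signedBasis_of_ne hpq.symm, real_inner_self_eq_norm_sq, norm_signedBasis]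
      ring
    have h := measure_mul_lintegral_sub_sq_le_of_subset_inter
      (ball_subset_ballCap hr h8 (norm_signedBasis p) hzn h1)
      (ball_subset_ballCap hr h8 (norm_signedBasis q) hzn h2) (by rw [hβ]; exact hβt)
      (hvm.mono_measure (Measure.restrict_mono_set _ ((hcapA p).trans Set.sdiff_subset))) c
    rw [hβ] at h
    refine (ENNReal.mul_le_mul_iff_right hβ0 hβt).1 (h.trans ?_)
    calc 4 * ((∫⁻ x in ballCap ρ r (signedBasis q), ∫⁻ y in ballCap ρ r (signedBasis q),
            ‖v y - v x‖ₑ ^ 2) + volume (ballCap ρ r (signedBasis q)) *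
            ∫⁻ x in ballCap ρ r (signedBasis p), ‖v x - c‖ₑ ^ 2)
        ≤ 4 * (β * (C₀ * X) + κ * β * (C * X)) := by
          gcongr
          · exact hpoin q
          · exact hcapV q
      _ = _ := by ring
  let i₀ : Fin d := ⟨0, by omega⟩
  let i₁ : Fin d := ⟨1, by omega⟩
  have hi : i₀ ≠ i₁ := by simp [i₀, i₁]
  set p₀ : Fin d × Bool := (i₀, true) with hp₀
  set I := Metric.ball ((2 * r) • signedBasis p₀) (r / 2) with hI
  have hIcap : I ⊆ ballCap ρ r (signedBasis p₀) := by
    refine ball_subset_ballCap hr h8 (norm_signedBasis p₀) ?_ ?_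
    · rw [norm_smul, norm_signedBasis, Real.norm_of_nonneg (by positivity)]
      linarith
    · rw [inner_smul_right, real_inner_self_eq_norm_sq, norm_signedBasis]
      ring
  have hIβ : volume I = β := hβ _
  have hvI : IntegrableOn v I := by
    have : IsFiniteMeasure (volume.restrict (originBall d (5 * d * r))) :=
      ⟨by simpa using measure_ball_lt_top⟩
    exact (hv.memLp.integrable (by norm_num)).mono_measure
      (Measure.restrict_mono_set _ (hIcap.trans ((hcapA p₀).trans Set.sdiff_subset)))
  set c := ⨍ y in I, v y with hc
  have base : ∫⁻ x in ballCap ρ r (signedBasis p₀), ‖v x - c‖ₑ ^ 2 ≤ C₀ * X := by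
    have h := measure_mul_lintegral_sub_setAverage_sq_le (hIβ ▸ hβ0) (hIβ ▸ hβt) hIcap hvI
    rw [hIβ] at h
    exact (ENNReal.mul_le_mul_iff_right hβ0 hβt).1 (h.trans (hpoin p₀))
  have hall : ∀ p : Fin d × Bool,
      ∫⁻ x in ballCap ρ r (signedBasis p), ‖v x - c‖ₑ ^ 2 ≤ (C₀ + C₁ + C₂) * X := by
    intro p
    -- The cap opposite to the reference cap does not meet it, so caps on the axis `i₀` are reached
    -- through one on the axis `i₁`; a second axis exists because `d ≥ 2`.
    by_cases hp : p.1 = i₀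
    · have s1 := step p₀ (i₁, true) hi c C₀ base
      have s2 := step (i₁, true) p (by rw [hp]; exact hi.symm) c C₁ s1
      refine s2.trans ?_
      gcongr
      exact le_add_self
    · refine (step p₀ p (fun h => hp h.symm) c C₀ base).trans ?_
      gcongr
      exact le_add_self.trans le_self_add
  refine ⟨c, ?_, ?_⟩
  · have h := measure_mul_enorm_setAverage_sq_le (hIβ ▸ hβ0) (hIβ ▸ hβt) hvI.aemeasurable
    rw [hIβ] at h
    calc volume (originBall d (5 * d * r)) * ‖c‖ₑ ^ 2 = κ * (β * ‖c‖ₑ ^ 2) := by rw [hvol]; ring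
      _ ≤ (κ + N * (C₀ + C₁ + C₂)) * ∫⁻ x in A, ‖v x‖ₑ ^ 2 := by
        gcongr
        · exact le_self_add
        · exact h.trans (lintegral_mono_set (hIcap.trans (hcapA p₀)))
  · calc ∫⁻ x in originBall d ρ \ originBall d (d * r), ‖v x - c‖ₑ ^ 2
        ≤ ∫⁻ x in ⋃ p : Fin d × Bool, ballCap ρ r (signedBasis p), ‖v x - c‖ₑ ^ 2 :=
          lintegral_mono_set (annulus_subset_iUnion_ballCap hd hr)
      _ ≤ ∑' p : Fin d × Bool, ∫⁻ x in ballCap ρ r (signedBasis p), ‖v x - c‖ₑ ^ 2 :=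
          lintegral_iUnion_le _ _
      _ ≤ ∑ p : Fin d × Bool, (C₀ + C₁ + C₂) * X := by
          rw [tsum_fintype]
          exact Finset.sum_le_sum fun p _ => hall p
      _ = N * (C₀ + C₁ + C₂) * X := by
          rw [Finset.sum_const, Finset.card_univ, nsmul_eq_mul, mul_assoc]
      _ ≤ _ := by
          gcongr
          exact le_add_self

/-- The Poincaré inequality on an annulus in terms of Bochner integrals. -/
theorem exists_integral_poincare_annulus {d : ℕ} (hd : 2 ≤ d) :
    ∃ C : ℝ, 0 ≤ C ∧ ∀ r : ℝ, 0 < r → ∀ (v : Euc d → ℝ) (Dv : Euc d → Euc d),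
      MemH1 (originBall d (5 * d * r)) v Dv → ∃ c : ℝ,
        volume.real (originBall d (5 * d * r)) * c ^ 2 ≤
          C * ∫ x in originBall d (5 * d * r) \ originBall d r, v x ^ 2 ∧
        ∫ x in originBall d (4 * d * r) \ originBall d (d * r), (v x - c) ^ 2 ≤
          C * (r ^ 2 * ∫ x in originBall d (5 * d * r) \ originBall d r, ‖Dv x‖ ^ 2) := by
  obtain ⟨C, hC, h⟩ := exists_poincare_annulus hd
  refine ⟨C.toReal, ENNReal.toReal_nonneg, fun r hr v Dv hv => ?_⟩
  obtain ⟨c, h1, h2⟩ := h r hr v Dv hv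
  have hfin : IsFiniteMeasure (volume.restrict (originBall d (5 * d * r))) :=
    ⟨by simpa using measure_ball_lt_top⟩
  have hdr : 0 ≤ d * r := by positivity
  have hm1 : volume.restrict (originBall d (5 * d * r) \ originBall d r) ≤
      volume.restrict (originBall d (5 * d * r)) :=
    Measure.restrict_mono_set _ Set.sdiff_subset
  have hm2 : volume.restrict (originBall d (4 * d * r) \ originBall d (d * r)) ≤
      volume.restrict (originBall d (5 * d * r)) :=
    Measure.restrict_mono_set _
      (Set.sdiff_subset.trans (Metric.ball_subset_ball (by nlinarith)))
  have n1 : MemLp v 2 (volume.restrict (originBall d (5 * d * r) \ originBall d r)) :=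
    hv.memLp.mono_measure hm1
  have n2 : MemLp Dv 2 (volume.restrict (originBall d (5 * d * r) \ originBall d r)) :=
    hv.memLp_grad.mono_measure hm1
  have n3 : MemLp (fun x => v x - c) 2
      (volume.restrict (originBall d (4 * d * r) \ originBall d (d * r))) :=
    (hv.memLp.sub (memLp_const c)).mono_measure hm2
  rw [lintegral_enorm_sq_eq_ofReal n1] at h1
  rw [lintegral_enorm_sq_eq_ofReal n2, lintegral_enorm_sq_eq_ofReal n3] at h2
  simp only [Real.norm_eq_abs, sq_abs] at h1 h2
  refine ⟨c, ?_, ?_⟩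
  · have := ENNReal.toReal_mono (by finiteness) h1
    rw [ENNReal.toReal_mul, ENNReal.toReal_mul, ENNReal.toReal_pow, toReal_enorm,
      ENNReal.toReal_ofReal (integral_nonneg fun x => sq_nonneg _), Real.norm_eq_abs, sq_abs] at this
    exact this
  · have := ENNReal.toReal_mono (by finiteness) h2
    rwa [ENNReal.toReal_mul, ENNReal.toReal_mul, ENNReal.toReal_pow,
      ENNReal.toReal_ofReal (integral_nonneg fun x => sq_nonneg _),
      ENNReal.toReal_ofReal (integral_nonneg fun x => sq_nonneg _),
      ENNReal.toReal_ofReal hr.le] at this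

/-! ### Caccioppoli estimate and hole filling -/

/-- Cutoff functions on balls with a scale invariant gradient bound. -/
theorem exists_cutoff {d : ℕ} (hd : 2 ≤ d) :
    ∃ M : ℝ, 0 ≤ M ∧ ∀ r : ℝ, 0 < r → ∃ χ : Euc d → ℝ,
      IsTestFunction (originBall d (4 * d * r)) χ ∧ (∀ x, 0 ≤ χ x ∧ χ x ≤ 1) ∧
      (∀ x ∈ originBall d (d * r), χ x = 1 ∧ gradient χ x = 0) ∧
      ∀ x, ‖gradient χ x‖ ≤ M / r := by
  have hd' : (2 : ℝ) ≤ d := by exact_mod_cast hd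
  let χ : ContDiffBump (0 : Euc d) := ⟨d, 2 * d, by linarith, by linarith⟩
  have hc : Continuous (fderiv ℝ χ) := χ.contDiff.continuous_fderiv (n := ∞) (by simp)
  obtain ⟨M, hM⟩ := hc.bounded_above_of_compact_support (χ.hasCompactSupport.fderiv (𝕜 := ℝ))
  refine ⟨M, (norm_nonneg _).trans (hM 0), fun r hr => ?_⟩
  have hsm : ContDiff ℝ ∞ fun x => χ (r⁻¹ • x) := χ.contDiff.comp (contDiff_const_smul _)
  have hone : ∀ x ∈ originBall d (d * r), χ (r⁻¹ • x) = 1 := by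
    intro x hx
    refine χ.one_of_mem_closedBall ?_
    have h1 : ‖x‖ < d * r := mem_ball_zero_iff.1 hx
    rw [mem_closedBall_zero_iff, norm_smul, norm_inv, Real.norm_of_nonneg hr.le,
      inv_mul_le_iff₀ hr, mul_comm]
    exact h1.le
  have hsupp : tsupport (fun x => χ (r⁻¹ • x)) ⊆ Metric.closedBall 0 (2 * d * r) := by
    refine closure_minimal (fun x hx => ?_) Metric.isClosed_closedBall
    have hx' : r⁻¹ • x ∈ Function.support χ := hx
    rw [χ.support_eq, mem_ball_zero_iff, norm_smul, norm_inv, Real.norm_of_nonneg hr.le,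
      inv_mul_lt_iff₀ hr] at hx'
    have : ‖x‖ < r * (2 * d) := hx'
    rw [mem_closedBall_zero_iff]
    linarith
  refine ⟨fun x => χ (r⁻¹ • x), ⟨hsm, ?_, ?_⟩, fun x => ⟨χ.nonneg, χ.le_one⟩, ?_, ?_⟩
  · exact (isCompact_closedBall _ _).of_isClosed_subset (isClosed_tsupport _) hsupp
  · exact hsupp.trans (Metric.closedBall_subset_ball (by nlinarith))
  · intro x hx
    refine ⟨hone x hx, ?_⟩
    have : (fun x => χ (r⁻¹ • x)) =ᶠ[nhds x] fun _ => 1 :=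
      Filter.eventuallyEq_of_mem (Metric.isOpen_ball.mem_nhds hx) hone
    rw [this.gradient_eq, gradient_fun_const]
  · intro x
    rw [norm_gradient, fderiv_comp_smul, norm_smul, norm_inv, Real.norm_of_nonneg hr.le,
      div_eq_inv_mul]
    gcongr
    exact hM _

/-- The integrand of the tested equation at one point: `k = χ`, `m = |∇χ|`, `s = |Dv|`, `G = |g|`,
`q = Dv·ADv`, `p = Dv·g`, `z = ∇χ·(ADv + g)`, `τ = T⁻¹`. Young is applied to the terms in `p` and
`z` so that each consumes `lam/4` of the ellipticity `lam`, leaving `lam/2`. The massive term uses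
`(v - f)(v - c) ≥ v²/2 - 2(c² + f²)`. -/
theorem energy_young {lam τ k v c f s G m q p z : ℝ} (hl0 : 0 < lam) (hl1 : lam ≤ 1) (hτ : 0 ≤ τ)
    (hk : 0 ≤ k) (hq : lam * s ^ 2 ≤ q) (hp : |p| ≤ s * G) (hz : |z| ≤ m * (s + G)) :
    lam / 2 * (k ^ 2 * (τ * v ^ 2 + s ^ 2)) ≤
      (τ * (v - f) * (k * k * (v - c)) + (k * k * (q + p) + (v - c) * (2 * k * z))) +
      (2 * (τ * (c ^ 2 + f ^ 2)) * k ^ 2 + 2 / lam * (k ^ 2 * G ^ 2) +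
        5 / lam * (m ^ 2 * (v - c) ^ 2)) := by
  obtain ⟨μ, hμ⟩ : ∃ μ, μ = 1 / lam := ⟨_, rfl⟩
  have hlμ : lam * μ = 1 := by rw [hμ]; field_simp
  have hμ1 : 1 ≤ μ := by rw [hμ, le_div_iff₀ hl0]; linarith
  have e2 : 2 / lam = 2 * μ := by rw [hμ]; ring
  have e5 : 5 / lam = 5 * μ := by rw [hμ]; ring
  rw [e2, e5]
  set y := v - c with hy
  have ha : τ * k ^ 2 * (v ^ 2 / 2) ≤ τ * k ^ 2 * ((v - f) * y + 2 * (c ^ 2 + f ^ 2)) := by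
    refine mul_le_mul_of_nonneg_left ?_ (by positivity)
    rw [hy]
    nlinarith [sq_nonneg (v / 2 - c), sq_nonneg (v / 2 - f), sq_nonneg (c + f), sq_nonneg c,
      sq_nonneg f]
  have ha' : lam * (τ * k ^ 2 * (v ^ 2 / 2)) ≤ 1 * (τ * k ^ 2 * (v ^ 2 / 2)) :=
    mul_le_mul_of_nonneg_right hl1 (by positivity)
  have hb : 0 ≤ k ^ 2 * (lam / 4 * s ^ 2 + μ * G ^ 2 + p) := by
    refine mul_nonneg (by positivity) ?_
    have h1 : 0 ≤ lam * (s / 2 - μ * G) ^ 2 := by positivity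
    have h2 : lam * (s / 2 - μ * G) ^ 2 =
      lam / 4 * s ^ 2 - (lam * μ) * (s * G) + (lam * μ) * μ * G ^ 2 := by ring
    rw [hlμ] at h2
    have := (abs_le.1 hp).1
    linarith
  have hc : |y * (2 * k * z)| ≤
      lam / 4 * (k ^ 2 * s ^ 2) + 4 * μ * (m ^ 2 * y ^ 2) + k ^ 2 * G ^ 2 + m ^ 2 * y ^ 2 := by
    have h0 : |y * (2 * k * z)| ≤ |y| * (2 * k * (m * (s + G))) := by
      rw [abs_mul, abs_mul, abs_of_nonneg (by positivity : 0 ≤ 2 * k)]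
      gcongr
    have h1 : 0 ≤ lam * (k * s / 2 - 2 * μ * (|y| * m)) ^ 2 := by positivity
    have h2 : lam * (k * s / 2 - 2 * μ * (|y| * m)) ^ 2 = lam / 4 * (k ^ 2 * s ^ 2) -
        (lam * μ) * (2 * k * s * (|y| * m)) + 4 * (lam * μ) * μ * (m ^ 2 * |y| ^ 2) := by ring
    rw [hlμ, sq_abs] at h2
    have h3 : 0 ≤ (k * G - |y| * m) ^ 2 := sq_nonneg _
    have h4 : (k * G - |y| * m) ^ 2 = k ^ 2 * G ^ 2 - 2 * k * G * (|y| * m) + m ^ 2 * |y| ^ 2 := by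
      ring
    rw [sq_abs] at h4
    linarith
  have hc' := (abs_le.1 hc).1
  have hq' : k ^ 2 * (lam * s ^ 2) ≤ k ^ 2 * q := mul_le_mul_of_nonneg_left hq (by positivity)
  have hG : 0 ≤ (μ - 1) * (k ^ 2 * G ^ 2) := mul_nonneg (by linarith) (by positivity)
  have hY : 0 ≤ (μ - 1) * (m ^ 2 * y ^ 2) := mul_nonneg (by linarith) (by positivity)
  nlinarith

/-- The density `T⁻¹ v² + |Dv|²` of the massive energy. -/
noncomputable def energyDensity {d : ℕ} (T : ℝ) (v : Euc d → ℝ) (Dv : Euc d → Euc d)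
    (x : Euc d) : ℝ :=
  T⁻¹ * v x ^ 2 + ‖Dv x‖ ^ 2

theorem energyDensity_nonneg {d : ℕ} {T : ℝ} (hT : 0 < T) (v : Euc d → ℝ) (Dv : Euc d → Euc d)
    (x : Euc d) : 0 ≤ energyDensity T v Dv x := by
  unfold energyDensity; positivity

theorem integrable_energyDensity {d : ℕ} (T : ℝ) {v : Euc d → ℝ} {Dv : Euc d → Euc d}
    {μ : Measure (Euc d)} (hv : MemLp v 2 μ) (hDv : MemLp Dv 2 μ) :
    Integrable (energyDensity T v Dv) μ :=
  (hv.integrable_sq.const_mul _).fun_add (integrable_norm_sq hDv)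

theorem IsCoefficientField.memLp_apply {d : ℕ} {lam : ℝ} {A : Euc d → (Euc d →L[ℝ] Euc d)}
    (hA : IsCoefficientField lam A) {U : Set (Euc d)} {F : Euc d → Euc d}
    (hF : MemLp F 2 (volume.restrict U)) : MemLp (fun x => A x (F x)) 2 (volume.restrict U) := by
  refine hF.mono ?_ (Eventually.of_forall fun x => hA.bounded x _)
  exact (ContinuousLinearMap.measurable_apply₂.comp_aemeasurable
    (hA.aemeasurable.restrict.prodMk hF.1.aemeasurable)).aestronglyMeasurable

/-- Widman's hole filling inequality for the inhomogeneous massive equation. -/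
theorem exists_hole_filling {d : ℕ} (hd : 2 ≤ d) {lam : ℝ} (hl0 : 0 < lam) (hl1 : lam ≤ 1) :
    ∃ C : ℝ, 1 ≤ C ∧ ∀ A : Euc d → (Euc d →L[ℝ] Euc d), IsCoefficientField lam A →
      ∀ r T : ℝ, 0 < r → 0 < T → ∀ (v f : Euc d → ℝ) (Dv g : Euc d → Euc d),
        MemH1 (originBall d (5 * d * r)) v Dv →
        MemLp f 2 (volume.restrict (originBall d (5 * d * r))) →
        MemLp g 2 (volume.restrict (originBall d (5 * d * r))) →
        (∀ η, IsTestFunction (originBall d (5 * d * r)) η →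
          ∫ x in originBall d (5 * d * r),
            (T⁻¹ * (v x - f x) * η x + fderiv ℝ η x (A x (Dv x) + g x)) = 0) →
        ∫ x in originBall d r, energyDensity T v Dv x ≤
          C * ((∫ x in originBall d (5 * d * r) \ originBall d r, energyDensity T v Dv x) +
            ∫ x in originBall d (5 * d * r), energyDensity T f g x) := by
  obtain ⟨Cp, hCp, hpoin⟩ := exists_integral_poincare_annulus hd
  obtain ⟨M, hM, hcut⟩ := exists_cutoff hd
  have hd' : (2 : ℝ) ≤ d := by exact_mod_cast hd
  -- `2 * Cp` pays for `T⁻¹c²`, `2 + 2 / lam` for the data `f`, `g`, and the last summand for the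
  -- cutoff gradient through Poincaré. The prefactor `2 / lam` chosen below undoes the `lam / 2` of
  -- `energy_young`.
  set B := 2 * Cp + 2 + 2 / lam + 5 / lam * M ^ 2 * Cp with hB
  have hB0 : 2 ≤ B := by
    have : 0 ≤ 2 * Cp + 2 / lam + 5 / lam * M ^ 2 * Cp := by positivity
    rw [hB]; linarith
  refine ⟨2 / lam * B, ?_, ?_⟩
  · have : 2 ≤ 2 / lam := by rw [le_div_iff₀ hl0]; linarith
    nlinarith
  intro A hA r T hr hT v f Dv g hv hf hg heq
  set U := originBall d (5 * d * r) with hU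
  set W := U \ originBall d r with hW
  set N := originBall d (4 * d * r) \ originBall d (d * r) with hN
  have hfin : IsFiniteMeasure (volume.restrict U) := ⟨by simpa using measure_ball_lt_top⟩
  have hdr : 2 * r ≤ d * r := by gcongr
  obtain ⟨c, hc1, hc2⟩ := hpoin r hr v Dv hv
  obtain ⟨χ, hχ, hχ01, hχ1, hχM⟩ := hcut r hr
  have hχU : IsTestFunction U χ := hχ.mono (Metric.ball_subset_ball (by nlinarith))
  have hχ2 : IsTestFunction U (fun x => χ x * χ x) := hχU.mul hχU.contDiff
  have hvc : MemH1 U (fun x => v x - c) Dv := hv.sub_const measure_ball_lt_top.ne c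
  have hw := hvc.testFunction_mul measurableSet_ball hχ2
  have hAD : MemLp (fun x => A x (Dv x)) 2 (volume.restrict U) := hA.memLp_apply hv.memLp_grad
  have hF : MemLp (fun x => A x (Dv x) + g x) 2 (volume.restrict U) := hAD.add hg
  have ha : MemLp (fun x => T⁻¹ * (v x - f x)) 2 (volume.restrict U) :=
    (hv.memLp.sub hf).const_mul T⁻¹
  -- The equation is tested with `χ²(v - c)`.
  have hI := MemH1.integral_eq_zero_of_forall_testFunction Metric.isOpen_ball ha hF heq
    hχ2.hasCompactSupport.isCompact hχ2.tsupport_subset hw fun x hx => by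
      rw [image_eq_zero_of_notMem_tsupport hx, zero_mul]
  have hw2 : MemLp (fun x => χ x * χ x * (v x - c)) 2 (volume.restrict U) := by
    have := hw.memLp.restrict U
    rwa [Measure.restrict_univ] at this
  have hDw2 : MemLp (fun x => (χ x * χ x) • Dv x + (v x - c) • gradient (fun x => χ x * χ x) x) 2
      (volume.restrict U) := by
    have := hw.memLp_grad.restrict U
    rwa [Measure.restrict_univ] at this
  have iI : Integrable (fun x => T⁻¹ * (v x - f x) * (χ x * χ x * (v x - c)) +
      inner ℝ ((χ x * χ x) • Dv x + (v x - c) • gradient (fun x => χ x * χ x) x)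
        (A x (Dv x) + g x)) (volume.restrict U) :=
    (ha.integrable_mul hw2).add (integrable_inner_of_memLp hDw2 hF)
  have iE : Integrable (energyDensity T v Dv) (volume.restrict U) :=
    integrable_energyDensity T hv.memLp hv.memLp_grad
  have ifg : Integrable (energyDensity T f g) (volume.restrict U) :=
    integrable_energyDensity T hf hg
  have iy : Integrable (fun x => (v x - c) ^ 2) (volume.restrict U) := hvc.memLp.integrable_sq
  have iyN : Integrable (N.indicator fun x => (v x - c) ^ 2) (volume.restrict U) :=
    iy.indicator (measurableSet_ball.diff measurableSet_ball)
  have ic : Integrable (fun _ : Euc d => T⁻¹ * c ^ 2) (volume.restrict U) := integrable_const _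
  have iE2 : Integrable ((originBall d r).indicator (energyDensity T v Dv)) (volume.restrict U) :=
    iE.indicator measurableSet_ball
  have pointwise : ∀ x, lam / 2 * (originBall d r).indicator (energyDensity T v Dv) x ≤
      (T⁻¹ * (v x - f x) * (χ x * χ x * (v x - c)) +
      inner ℝ ((χ x * χ x) • Dv x + (v x - c) • gradient (fun x => χ x * χ x) x)
        (A x (Dv x) + g x)) + (2 * (T⁻¹ * c ^ 2) + ((2 + 2 / lam) * energyDensity T f g x +
        5 / lam * (M / r) ^ 2 * N.indicator (fun x => (v x - c) ^ 2) x)) := by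
    intro x
    obtain ⟨hk0, hk1⟩ := hχ01 x
    have hk2 : χ x ^ 2 ≤ 1 := pow_le_one₀ hk0 hk1
    have hz : |inner ℝ (gradient χ x) (A x (Dv x) + g x)| ≤
        ‖gradient χ x‖ * (‖Dv x‖ + ‖g x‖) := by
      refine (abs_real_inner_le_norm _ _).trans ?_
      gcongr
      exact (norm_add_le _ _).trans (by gcongr; exact hA.bounded x _)
    have hmain := energy_young (τ := T⁻¹) (v := v x) (c := c) (f := f x) hl0 hl1
      (by positivity) hk0 (hA.elliptic x (Dv x)) (abs_real_inner_le_norm (Dv x) (g x)) hz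
    have hin : inner ℝ ((χ x * χ x) • Dv x + (v x - c) • gradient (fun x => χ x * χ x) x)
        (A x (Dv x) + g x) = χ x * χ x * (inner ℝ (Dv x) (A x (Dv x)) + inner ℝ (Dv x) (g x)) +
        (v x - c) * (2 * χ x * inner ℝ (gradient χ x) (A x (Dv x) + g x)) := by
      rw [inner_add_left, real_inner_smul_left, real_inner_smul_left, inner_gradient_left,
        fderiv_mul_apply_of_contDiff hχ.contDiff hχ.contDiff, inner_gradient_left, inner_add_right]
      ring
    have hlow : (originBall d r).indicator (energyDensity T v Dv) x ≤
        χ x ^ 2 * (T⁻¹ * v x ^ 2 + ‖Dv x‖ ^ 2) := by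
      by_cases hx : x ∈ originBall d r
      · rw [Set.indicator_of_mem hx,
          (hχ1 x (Metric.ball_subset_ball (by linarith) hx)).1, one_pow, one_mul]
        exact le_rfl
      · rw [Set.indicator_of_notMem hx]
        positivity
    have hgrad : ‖gradient χ x‖ ^ 2 * (v x - c) ^ 2 ≤
        (M / r) ^ 2 * N.indicator (fun x => (v x - c) ^ 2) x := by
      by_cases hx : x ∈ N
      · rw [Set.indicator_of_mem hx]
        gcongr
        exact hχM x
      · have : gradient χ x = 0 := by
          by_cases h4 : x ∈ originBall d (4 * d * r)
          · exact (hχ1 x (by_contra fun h => hx ⟨h4, h⟩)).2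
          · exact hχ.gradient_eq_zero h4
        rw [Set.indicator_of_notMem hx, this]
        simp
    rw [hin]
    have t1 : lam / 2 * (originBall d r).indicator (energyDensity T v Dv) x ≤
      lam / 2 * (χ x ^ 2 * (T⁻¹ * v x ^ 2 + ‖Dv x‖ ^ 2)) := by gcongr
    have t2 : 2 * (T⁻¹ * (c ^ 2 + f x ^ 2)) * χ x ^ 2 ≤ 2 * (T⁻¹ * (c ^ 2 + f x ^ 2)) * 1 := by
      gcongr
    have t3 : 2 / lam * (χ x ^ 2 * ‖g x‖ ^ 2) ≤ 2 / lam * (1 * ‖g x‖ ^ 2) := by gcongr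
    have t4 : 5 / lam * (‖gradient χ x‖ ^ 2 * (v x - c) ^ 2) ≤
      5 / lam * ((M / r) ^ 2 * N.indicator (fun x => (v x - c) ^ 2) x) := by gcongr
    have t5 : 0 ≤ 2 * ‖g x‖ ^ 2 + 2 / lam * (T⁻¹ * f x ^ 2) := by positivity
    have t6 : (2 + 2 / lam) * energyDensity T f g x = 2 * (T⁻¹ * f x ^ 2) + 2 * ‖g x‖ ^ 2 +
      2 / lam * (T⁻¹ * f x ^ 2) + 2 / lam * ‖g x‖ ^ 2 := by unfold energyDensity; ring
    rw [t6]
    linarith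
  have iR2 : Integrable (fun x => (2 + 2 / lam) * energyDensity T f g x +
        5 / lam * (M / r) ^ 2 * N.indicator (fun x => (v x - c) ^ 2) x) (volume.restrict U) :=
    (ifg.const_mul _).add (iyN.const_mul _)
  have iR1 : Integrable (fun x => 2 * (T⁻¹ * c ^ 2) + ((2 + 2 / lam) * energyDensity T f g x +
        5 / lam * (M / r) ^ 2 * N.indicator (fun x => (v x - c) ^ 2) x)) (volume.restrict U) :=
    (ic.const_mul 2).add iR2
  have hmono := integral_mono (iE2.const_mul (lam / 2)) (iI.fun_add iR1) pointwise
  have hrU : originBall d r ⊆ U := Metric.ball_subset_ball (by nlinarith)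
  have hNU : N ⊆ U := Set.sdiff_subset.trans (Metric.ball_subset_ball (by nlinarith))
  have hNm : MeasurableSet N := measurableSet_ball.diff measurableSet_ball
  have e1 : ∫ x in U, (originBall d r).indicator (energyDensity T v Dv) x =
      ∫ x in originBall d r, energyDensity T v Dv x := by
    rw [setIntegral_indicator measurableSet_ball, Set.inter_eq_right.2 hrU]
  have e2 : ∫ x in U, N.indicator (fun x => (v x - c) ^ 2) x = ∫ x in N, (v x - c) ^ 2 := by
    rw [setIntegral_indicator hNm, Set.inter_eq_right.2 hNU]
  have e3 : ∫ _x in U, 2 * (T⁻¹ * c ^ 2) = 2 * (volume.real U * (T⁻¹ * c ^ 2)) := by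
    rw [setIntegral_const, smul_eq_mul]
    ring
  rw [integral_const_mul, integral_add iI iR1, hI, zero_add,
    integral_add (ic.const_mul 2) iR2, integral_add (ifg.const_mul _) (iyN.const_mul _), e3,
    integral_const_mul, integral_const_mul, e1, e2] at hmono
  have iEW : Integrable (energyDensity T v Dv) (volume.restrict W) :=
    iE.mono_measure (Measure.restrict_mono_set _ Set.sdiff_subset)
  have ivW : Integrable (fun x => v x ^ 2) (volume.restrict W) :=
    hv.memLp.integrable_sq.mono_measure (Measure.restrict_mono_set _ Set.sdiff_subset)
  have iDW : Integrable (fun x => ‖Dv x‖ ^ 2) (volume.restrict W) :=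
    (integrable_norm_sq hv.memLp_grad).mono_measure
      (Measure.restrict_mono_set _ Set.sdiff_subset)
  set EW := ∫ x in W, energyDensity T v Dv x with hEW
  have hEW' : EW = T⁻¹ * (∫ x in W, v x ^ 2) + ∫ x in W, ‖Dv x‖ ^ 2 := by
    rw [← integral_const_mul, ← integral_add (ivW.const_mul _) iDW]
    rfl
  have p1 : 0 ≤ ∫ x in W, v x ^ 2 := integral_nonneg fun x => sq_nonneg _
  have p2 : 0 ≤ ∫ x in W, ‖Dv x‖ ^ 2 := integral_nonneg fun x => sq_nonneg _
  have hTi : 0 < T⁻¹ := by positivity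
  -- Although `T⁻¹c²` is integrated over all of `U`, its integral is bounded by the energy in the
  -- annulus `W`, so the hole does not reappear on the right.
  have q1 : 2 * (volume.real U * (T⁻¹ * c ^ 2)) ≤ 2 * Cp * EW := by
    calc 2 * (volume.real U * (T⁻¹ * c ^ 2)) = 2 * T⁻¹ * (volume.real U * c ^ 2) := by ring
      _ ≤ 2 * T⁻¹ * (Cp * ∫ x in W, v x ^ 2) := by gcongr
      _ = 2 * Cp * (T⁻¹ * ∫ x in W, v x ^ 2) := by ring
      _ ≤ 2 * Cp * EW := by gcongr; linarith
  -- The factor `r²` of Poincaré cancels the `r⁻²` of the cutoff gradient, so the constant is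
  -- independent of scale.
  have q2 : 5 / lam * (M / r) ^ 2 * ∫ x in N, (v x - c) ^ 2 ≤ 5 / lam * M ^ 2 * Cp * EW := by
    calc 5 / lam * (M / r) ^ 2 * ∫ x in N, (v x - c) ^ 2
        ≤ 5 / lam * (M / r) ^ 2 * (Cp * (r ^ 2 * ∫ x in W, ‖Dv x‖ ^ 2)) := by gcongr
      _ = 5 / lam * M ^ 2 * Cp * ∫ x in W, ‖Dv x‖ ^ 2 := by field_simp
      _ ≤ _ := by
          gcongr
          have : 0 ≤ T⁻¹ * ∫ x in W, v x ^ 2 := by positivity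
          linarith
  have hEW0 : 0 ≤ EW := integral_nonneg fun x => energyDensity_nonneg hT _ _ _
  set FG := ∫ x in U, energyDensity T f g x with hFG
  have hFG0 : 0 ≤ FG := integral_nonneg fun x => energyDensity_nonneg hT _ _ _
  have hfinal : lam / 2 * ∫ x in originBall d r, energyDensity T v Dv x ≤ B * (EW + FG) := by
    have : 0 ≤ (2 + 2 / lam) * EW := by positivity
    have : 0 ≤ (2 * Cp + 5 / lam * M ^ 2 * Cp) * FG := by positivity
    rw [hB]
    nlinarith
  calc ∫ x in originBall d r, energyDensity T v Dv x
      = 2 / lam * (lam / 2 * ∫ x in originBall d r, energyDensity T v Dv x) := by field_simp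
    _ ≤ 2 / lam * (B * (EW + FG)) := by gcongr
    _ = _ := by ring

/-! ### One-scale contraction of the energy -/

/-- Solutions of the massive equation with coefficient field `A` lose a factor `θ` of energy when
passing from the ball of radius `5 d r` to the ball of radius `r`, up to the right-hand side. -/
def HasEnergyDecay {d : ℕ} (A : Euc d → (Euc d →L[ℝ] Euc d)) (θ : ℝ) : Prop :=
  ∀ r T : ℝ, 0 < r → 0 < T → ∀ (v f : Euc d → ℝ) (Dv g : Euc d → Euc d),
    MemH1 (originBall d (5 * d * r)) v Dv →
    MemLp f 2 (volume.restrict (originBall d (5 * d * r))) →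
    MemLp g 2 (volume.restrict (originBall d (5 * d * r))) →
    (∀ η, IsTestFunction (originBall d (5 * d * r)) η →
      ∫ x in originBall d (5 * d * r),
        (T⁻¹ * (v x - f x) * η x + fderiv ℝ η x (A x (Dv x) + g x)) = 0) →
    ∫ x in originBall d r, energyDensity T v Dv x ≤
      θ * ((∫ x in originBall d (5 * d * r), energyDensity T v Dv x) +
        ∫ x in originBall d (5 * d * r), energyDensity T f g x)

theorem exists_hasEnergyDecay {d : ℕ} (hd : 2 ≤ d) {lam : ℝ} (hl0 : 0 < lam) (hl1 : lam ≤ 1) :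
    ∃ θ : ℝ, 1 / 2 ≤ θ ∧ θ < 1 ∧
      ∀ A : Euc d → (Euc d →L[ℝ] Euc d), IsCoefficientField lam A → HasEnergyDecay A θ := by
  obtain ⟨C, hC, h⟩ := exists_hole_filling hd hl0 hl1
  have hd' : (2 : ℝ) ≤ d := by exact_mod_cast hd
  refine ⟨C / (1 + C), by rw [div_le_div_iff₀] <;> linarith, by rw [div_lt_one] <;> linarith, ?_⟩
  intro A hA r T hr hT v f Dv g hv hf hg heq
  have h1 := h A hA r T hr hT v f Dv g hv hf hg heq
  have iE := integrable_energyDensity T hv.memLp hv.memLp_grad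
  have hsub : originBall d r ⊆ originBall d (5 * d * r) :=
    Metric.ball_subset_ball (by nlinarith)
  -- Filling the hole: the annulus energy is the full energy minus that of `B_r`, so `C` times the
  -- latter moves to the left, giving the factor `C / (1 + C)`.
  rw [setIntegral_sdiff measurableSet_ball iE hsub] at h1
  rw [div_mul_eq_mul_div, le_div_iff₀ (by linarith)]
  linarith

/-! ### Restriction to subdomains, sums, and affine functions in `H¹` -/

theorem setIntegral_eq_of_testFunction {d : ℕ} {U V : Set (Euc d)} (hVU : V ⊆ U) {η : Euc d → ℝ}
    (hη : IsTestFunction V η) {Φ : Euc d → ℝ} (hΦ : ∀ x, η x = 0 → fderiv ℝ η x = 0 → Φ x = 0) :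
    ∫ x in V, Φ x = ∫ x in U, Φ x := by
  rw [integral_eq_setIntegral_of_forall_notMem fun x hx =>
      hΦ x (hη.eq_zero hx) (hη.fderiv_eq_zero hx),
    integral_eq_setIntegral_of_forall_notMem fun x hx =>
      hΦ x (hη.eq_zero fun h => hx (hVU h)) (hη.fderiv_eq_zero fun h => hx (hVU h))]

theorem MemH1.mono {d : ℕ} {U V : Set (Euc d)} (hVU : V ⊆ U) {v : Euc d → ℝ} {Dv : Euc d → Euc d}
    (h : MemH1 U v Dv) : MemH1 V v Dv := by
  refine ⟨h.memLp.mono_measure (Measure.restrict_mono_set _ hVU),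
    h.memLp_grad.mono_measure (Measure.restrict_mono_set _ hVU), fun η hη e => ?_⟩
  rw [setIntegral_eq_of_testFunction hVU hη fun x _ h => by simp [h],
    setIntegral_eq_of_testFunction hVU hη fun x h _ => by simp [h]]
  exact h.weak_grad η (hη.mono hVU) e

theorem MassiveEq.mono {d : ℕ} {U V : Set (Euc d)} (hVU : V ⊆ U) {T : ℝ} {v : Euc d → ℝ}
    {F : Euc d → Euc d} (h : MassiveEq U T v F) : MassiveEq V T v F := fun η hη => by
  rw [setIntegral_eq_of_testFunction hVU hη fun x h1 h2 => by simp [h1, h2]]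
  exact h η (hη.mono hVU)

theorem MemH1.add {d : ℕ} {U : Set (Euc d)} {v w : Euc d → ℝ} {Dv Dw : Euc d → Euc d}
    (hv : MemH1 U v Dv) (hw : MemH1 U w Dw) :
    MemH1 U (fun x => v x + w x) (fun x => Dv x + Dw x) := by
  refine ⟨hv.memLp.add hw.memLp, hv.memLp_grad.add hw.memLp_grad, fun η hη e => ?_⟩
  have hη2 : MemLp η 2 (volume.restrict U) := hη.memLp.restrict U
  have hηe : MemLp (fun x => fderiv ℝ η x e) 2 (volume.restrict U) := by
    have := (hη.memLp_gradient.inner_const (𝕜 := ℝ) e).restrict U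
    simpa only [inner_gradient_left] using this
  have i1 : Integrable (fun x => v x * fderiv ℝ η x e) (volume.restrict U) :=
    hv.memLp.integrable_mul hηe
  have i2 : Integrable (fun x => w x * fderiv ℝ η x e) (volume.restrict U) :=
    hw.memLp.integrable_mul hηe
  have i3 : Integrable (fun x => inner ℝ (Dv x) e * η x) (volume.restrict U) :=
    (hv.memLp_grad.inner_const (𝕜 := ℝ) e).integrable_mul hη2
  have i4 : Integrable (fun x => inner ℝ (Dw x) e * η x) (volume.restrict U) :=
    (hw.memLp_grad.inner_const (𝕜 := ℝ) e).integrable_mul hη2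
  simp_rw [inner_add_left, add_mul]
  rw [integral_add i1 i2, integral_add i3 i4, hv.weak_grad η hη e, hw.weak_grad η hη e]
  ring

theorem abs_inner_le_of_mem_originBall {d : ℕ} {ξ x : Euc d} (hξ : ‖ξ‖ = 1) {R : ℝ}
    (hx : x ∈ originBall d R) : |inner ℝ ξ x| ≤ R := by
  have h1 := abs_real_inner_le_norm ξ x
  have h2 : ‖x‖ < R := mem_ball_zero_iff.1 hx
  rw [hξ, one_mul] at h1
  linarith

theorem memLp_inner_left_originBall {d : ℕ} {ξ : Euc d} (hξ : ‖ξ‖ = 1) (R : ℝ) :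
    MemLp (fun x : Euc d => inner ℝ ξ x) 2 (volume.restrict (originBall d R)) := by
  have : IsFiniteMeasure (volume.restrict (originBall d R)) :=
    ⟨by simpa using measure_ball_lt_top⟩
  refine MemLp.of_bound (by fun_prop) R ?_
  filter_upwards [ae_restrict_mem measurableSet_ball] with x hx
  exact abs_inner_le_of_mem_originBall hξ hx

theorem memH1_inner_left {d : ℕ} {ξ : Euc d} (hξ : ‖ξ‖ = 1) (R : ℝ) :
    MemH1 (originBall d R) (fun x => inner ℝ ξ x) (fun _ => ξ) := by
  have : IsFiniteMeasure (volume.restrict (originBall d R)) :=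
    ⟨by simpa using measure_ball_lt_top⟩
  refine ⟨memLp_inner_left_originBall hξ R, memLp_const ξ, fun η hη e => ?_⟩
  have hηc := hη.contDiff.continuous
  have hfc : Continuous fun x => fderiv ℝ η x e :=
    (hη.contDiff.continuous_fderiv (by simp)).clm_apply continuous_const
  have hfs : HasCompactSupport fun x => fderiv ℝ η x e :=
    (hη.hasCompactSupport.fderiv (𝕜 := ℝ)).comp_left (g := fun L : Euc d →L[ℝ] ℝ => L e) rfl
  have hfd : ∀ x : Euc d, fderiv ℝ (fun x : Euc d => inner ℝ ξ x) x = innerSL ℝ ξ :=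
    fun x => (innerSL ℝ ξ).fderiv
  have h := integral_mul_fderiv_eq_neg_fderiv_mul_of_integrable (𝕜 := ℝ) (μ := volume)
    (f := fun x : Euc d => inner ℝ ξ x) (g := η) (v := e)
    (by
      simp_rw [hfd]
      exact (hηc.integrable_of_hasCompactSupport hη.hasCompactSupport).const_mul _)
    ((show Continuous fun x : Euc d => inner ℝ ξ x * fderiv ℝ η x e by
      fun_prop).integrable_of_hasCompactSupport hfs.mul_left)
    ((show Continuous fun x : Euc d => inner ℝ ξ x * η x by
      fun_prop).integrable_of_hasCompactSupport hη.hasCompactSupport.mul_left)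
    (fun x _ => (innerSL ℝ ξ).differentiableAt)
    (fun x _ => hη.contDiff.differentiable (by simp) x)
  simp_rw [hfd, innerSL_apply_apply] at h
  rw [integral_eq_setIntegral_of_forall_notMem fun x hx => by simp [hη.fderiv_eq_zero hx],
    integral_eq_setIntegral_of_forall_notMem fun x hx => by simp [hη.eq_zero hx], h]

/-! ### Iteration over scales and the three estimates -/

/-- Geometric iteration of a one-scale contraction. -/
theorem le_rpow_mul_of_contraction {θ K α q R : ℝ} (hθ : 1 / 2 ≤ θ) (hK : 1 < K) (hα : 0 < α)
    (hq : K ^ (2 * α) = q) (hq1 : 1 < q) (hθq : θ * q ^ 2 = 1) (hR : 1 ≤ R) {G : ℝ → ℝ}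
    (hG0 : 0 ≤ G R) (hmono : ∀ r, 0 < r → r ≤ R → G r ≤ G R)
    (hstep : ∀ r, 0 < r → K * r ≤ R → G r ≤ θ * G (K * r)) :
    G 1 ≤ 2 * (R ^ (-α)) ^ 2 * G R := by
  have hθ0 : 0 < θ := by linarith
  have hK0 : 0 < K := by linarith
  have hR0 : 0 < R := by linarith
  have hiter : ∀ n : ℕ, K ^ n ≤ R → G 1 ≤ θ ^ n * G (K ^ n) := by
    intro n
    induction n with
    | zero => intro _; simp
    | succ n ih =>
      intro hn
      have h1 : K ^ n ≤ K ^ (n + 1) := pow_le_pow_right₀ hK.le (Nat.le_succ n)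
      refine (ih (h1.trans hn)).trans ?_
      have h2 := hstep (K ^ n) (by positivity) (by rwa [pow_succ'] at hn)
      rw [pow_succ θ, mul_assoc, pow_succ' K]
      gcongr
  obtain ⟨n, hn1, hn2⟩ := exists_nat_pow_near hR hK
  refine ((hiter n hn1).trans (mul_le_mul_of_nonneg_left (hmono _ (by positivity) hn1)
    (by positivity))).trans ?_
  refine mul_le_mul_of_nonneg_right ?_ hG0
  have hsq : (R ^ (-α)) ^ 2 = (R ^ (2 * α))⁻¹ := by
    rw [← Real.rpow_natCast, ← Real.rpow_mul hR0.le, ← Real.rpow_neg hR0.le]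
    congr 1
    push_cast
    ring
  rw [hsq, ← div_eq_mul_inv, le_div_iff₀ (by positivity)]
  have hRq : R ^ (2 * α) ≤ q ^ (n + 1) := by
    calc R ^ (2 * α) ≤ (K ^ (n + 1)) ^ (2 * α) :=
          Real.rpow_le_rpow hR0.le hn2.le (by positivity)
      _ = q ^ (n + 1) := by
          rw [← hq, ← Real.rpow_natCast, ← Real.rpow_natCast, ← Real.rpow_mul hK0.le,
            ← Real.rpow_mul hK0.le, mul_comm]
  -- Both follow from `θ q² = 1`: since `q > 1`, one has `θ q = 1/q ≤ 1` and `q ≤ q² = 1/θ ≤ 2`. The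
  -- bound `q ≤ 2` absorbs the incomplete last step between `K ^ n` and `R`.
  have hθq1 : θ * q ≤ 1 := by nlinarith
  have hq2 : q ≤ 2 := by nlinarith
  calc θ ^ n * R ^ (2 * α) ≤ θ ^ n * q ^ (n + 1) := by gcongr
    _ = (θ * q) ^ n * q := by rw [mul_pow, pow_succ]; ring
    _ ≤ 1 * 2 := by
        gcongr
        exact pow_le_one₀ (by positivity) hθq1
    _ = 2 := one_mul 2

theorem volume_real_originBall {d : ℕ} {R : ℝ} (hR : 0 < R) :
    volume.real (originBall d R) = R ^ d * volume.real (originBall d 1) := by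
  have h := Measure.addHaar_ball_of_pos (volume : Measure (Euc d)) 0 hR
  rw [finrank_euclideanSpace_fin] at h
  rw [measureReal_def, measureReal_def, h, ENNReal.toReal_mul,
    ENNReal.toReal_ofReal (by positivity)]

theorem sqrt_le_mul_sqrt_of_le {a b t C : ℝ} (ht : 0 ≤ t) (hC : 2 ≤ C)
    (h : a ≤ 4 * t ^ 2 * b) : Real.sqrt a ≤ C * t * Real.sqrt b := by
  calc Real.sqrt a ≤ Real.sqrt ((2 * t) ^ 2 * b) := Real.sqrt_le_sqrt (h.trans (by linarith))
    _ = 2 * t * Real.sqrt b := by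
        rw [Real.sqrt_mul (by positivity), Real.sqrt_sq (by positivity)]
    _ ≤ C * t * Real.sqrt b := by gcongr

theorem setIntegral_energyDensity_mono {d : ℕ} {T : ℝ} (hT : 0 < T) {v : Euc d → ℝ}
    {Dv : Euc d → Euc d} {U V : Set (Euc d)} (hv : MemLp v 2 (volume.restrict U))
    (hDv : MemLp Dv 2 (volume.restrict U)) (hVU : V ⊆ U) :
    ∫ x in V, energyDensity T v Dv x ≤ ∫ x in U, energyDensity T v Dv x :=
  setIntegral_mono_set (integrable_energyDensity T hv hDv)
    (Eventually.of_forall fun x => energyDensity_nonneg hT v Dv x)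
    (Eventually.of_forall hVU)

theorem HasEnergyDecay.sqrt_energy_le {d : ℕ} (hd : 2 ≤ d) {A : Euc d → (Euc d →L[ℝ] Euc d)}
    {θ α q C : ℝ} (hA : HasEnergyDecay A θ) (hθ : 1 / 2 ≤ θ) (hα : 0 < α)
    (hq : (5 * d : ℝ) ^ (2 * α) = q) (hq1 : 1 < q) (hθq : θ * q ^ 2 = 1) (hC : 2 ≤ C) {R T : ℝ}
    (hR : 1 ≤ R) (hT : 0 < T) {v : Euc d → ℝ} {Dv : Euc d → Euc d}
    (hv : MemH1 (originBall d R) v Dv)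
    (heq : MassiveEq (originBall d R) T v (fun x => A x (Dv x))) :
    Real.sqrt (∫ x in originBall d 1, energyDensity T v Dv x) ≤
      C * R ^ (-α) * Real.sqrt (∫ x in originBall d R, energyDensity T v Dv x) := by
  have hd' : (2 : ℝ) ≤ d := by exact_mod_cast hd
  have hE0 : 0 ≤ ∫ x in originBall d R, energyDensity T v Dv x :=
    integral_nonneg fun x => energyDensity_nonneg hT v Dv x
  have h := le_rpow_mul_of_contraction (K := 5 * d) hθ (by linarith) hα hq hq1 hθq hR
    (G := fun r => ∫ x in originBall d r, energyDensity T v Dv x) hE0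
    (fun r _ hrR => setIntegral_energyDensity_mono hT hv.memLp hv.memLp_grad
      (Metric.ball_subset_ball hrR))
    (fun r hr hrR => by
      have hs : originBall d (5 * d * r) ⊆ originBall d R := Metric.ball_subset_ball hrR
      have h := hA r T hr hT v (fun _ => 0) Dv (fun _ => 0) (hv.mono hs) MemLp.zero' MemLp.zero'
        (fun η hη => by simpa using heq.mono hs η hη)
      simpa [energyDensity] using h)
  refine sqrt_le_mul_sqrt_of_le (by positivity) hC (h.trans ?_)
  gcongr
  norm_num

/-- `u = ξ·x + φ` solves `T⁻¹(u - ξ·x) - ∇·A∇u = 0`, so the decay applies with datum `f = ξ·x`,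
whose energy on `B_r` is at most `T⁻¹ r²|B_r|`. This datum grows with `r` and is absorbed into the
iterated quantity. -/
theorem HasEnergyDecay.sqrt_corrector_energy_le {d : ℕ} (hd : 2 ≤ d)
    {A : Euc d → (Euc d →L[ℝ] Euc d)} {θ α q C : ℝ} (hA : HasEnergyDecay A θ) (hθ : 1 / 2 ≤ θ)
    (hα : 0 < α) (hq : (5 * d : ℝ) ^ (2 * α) = q) (hq1 : 1 < q) (hθq : θ * q ^ 2 = 1)
    (hC : 2 ≤ C) {R T : ℝ} (hR : 1 ≤ R) (hT : 0 < T) {ξ : Euc d} (hξ : ‖ξ‖ = 1) {φ : Euc d → ℝ}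
    {Dφ : Euc d → Euc d} (hφ : MemH1Loc φ Dφ)
    (heq : MassiveEq Set.univ T φ (fun x => A x (ξ + Dφ x))) :
    Real.sqrt (∫ x in originBall d 1,
        (T⁻¹ * (inner ℝ ξ x + φ x) ^ 2 + ‖ξ + Dφ x‖ ^ 2)) ≤
      C * R ^ (-α) * Real.sqrt (∫ x in originBall d R,
        (T⁻¹ * (inner ℝ ξ x + φ x) ^ 2 + ‖ξ + Dφ x‖ ^ 2 + T⁻¹ * R ^ 2)) := by
  have hd' : (2 : ℝ) ≤ d := by exact_mod_cast hd
  have hR0 : 0 < R := by linarith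
  set u : Euc d → ℝ := fun x => inner ℝ ξ x + φ x with hu
  set Du : Euc d → Euc d := fun x => ξ + Dφ x with hDu
  set β := volume.real (originBall d 1) with hb
  have hb0 : 0 ≤ β := measureReal_nonneg
  have hmem : ∀ r, 0 < r → MemH1 (originBall d r) u Du := fun r hr =>
    (memH1_inner_left hξ r).add (hφ r hr)
  have hE0 : ∀ r, 0 ≤ ∫ x in originBall d r, energyDensity T u Du x := fun r =>
    integral_nonneg fun x => energyDensity_nonneg hT u Du x
  have hlin : ∀ r, 0 < r → ∫ x in originBall d r,
      energyDensity T (fun x => inner ℝ ξ x) (fun _ => (0 : Euc d)) x ≤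
        T⁻¹ * (r ^ (d + 2) * β) := by
    intro r hr
    have hfin : IsFiniteMeasure (volume.restrict (originBall d r)) :=
      ⟨by simpa using measure_ball_lt_top⟩
    calc ∫ x in originBall d r, energyDensity T (fun x => inner ℝ ξ x) (fun _ => (0 : Euc d)) x
        ≤ ∫ x in originBall d r, T⁻¹ * r ^ 2 := by
          refine setIntegral_mono_on (integrable_energyDensity T
            (memLp_inner_left_originBall hξ r) MemLp.zero') (integrable_const _)
            measurableSet_ball fun x hx => ?_
          have := abs_inner_le_of_mem_originBall hξ hx
          simp only [energyDensity, norm_zero, ne_eq, OfNat.ofNat_ne_zero, not_false_eq_true,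
            zero_pow, add_zero]
          gcongr T⁻¹ * ?_
          exact sq_le_sq' (abs_le.1 this).1 (abs_le.1 this).2
      _ = T⁻¹ * (r ^ (d + 2) * β) := by
          rw [setIntegral_const, smul_eq_mul, volume_real_originBall hr]
          ring
  have hKd : 2 ≤ θ * (5 * d : ℝ) ^ (d + 2) := by
    have h1 : (5 * d : ℝ) ^ 1 ≤ (5 * d : ℝ) ^ (d + 2) :=
      pow_le_pow_right₀ (by linarith) (by omega)
    rw [pow_one] at h1
    nlinarith
  -- Adding twice the datum bound makes the contraction homogeneous: one copy at scale `5dr` covers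
  -- the error of the step, and, as `θ (5d)^(d+2) ≥ 2`, the other covers both copies at scale `r`.
  have h := le_rpow_mul_of_contraction (K := 5 * d) hθ (by linarith) hα hq hq1 hθq hR
    (G := fun r => (∫ x in originBall d r, energyDensity T u Du x) +
      2 * (T⁻¹ * (r ^ (d + 2) * β))) (add_nonneg (hE0 R) (by positivity))
    (fun r hr hrR => by
      have := setIntegral_energyDensity_mono hT (hmem R hR0).memLp (hmem R hR0).memLp_grad
        (V := originBall d r) (Metric.ball_subset_ball hrR)
      gcongr)
    (fun r hr _ => by
      have hKr : 0 < 5 * d * r := by positivity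
      have h := hA r T hr hT u (fun x => inner ℝ ξ x) Du (fun _ => 0) (hmem _ hKr)
        (memLp_inner_left_originBall hξ _) MemLp.zero'
        (fun η hη => by
          simpa [hu, hDu] using heq.mono (Set.subset_univ _) η hη)
      have hl := hlin _ hKr
      have h2 : θ * ∫ x in originBall d (5 * d * r),
          energyDensity T (fun x => inner ℝ ξ x) (fun _ => (0 : Euc d)) x ≤
          θ * (T⁻¹ * ((5 * d * r) ^ (d + 2) * β)) := mul_le_mul_of_nonneg_left hl (by linarith)
      have h3 : 2 * (T⁻¹ * (r ^ (d + 2) * β)) ≤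
          θ * (5 * d : ℝ) ^ (d + 2) * (T⁻¹ * (r ^ (d + 2) * β)) := by gcongr
      have h4 : θ * (5 * d : ℝ) ^ (d + 2) * (T⁻¹ * (r ^ (d + 2) * β)) =
          θ * (T⁻¹ * ((5 * d * r) ^ (d + 2) * β)) := by
        rw [mul_pow (5 * d : ℝ) r]
        ring
      linarith)
  have hfinR : IsFiniteMeasure (volume.restrict (originBall d R)) :=
    ⟨by simpa using measure_ball_lt_top⟩
  have hrhs : ∫ x in originBall d R, (T⁻¹ * (inner ℝ ξ x + φ x) ^ 2 + ‖ξ + Dφ x‖ ^ 2 +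
      T⁻¹ * R ^ 2) = (∫ x in originBall d R, energyDensity T u Du x) +
        T⁻¹ * (R ^ (d + 2) * β) := by
    have i1 : Integrable (energyDensity T u Du) (volume.restrict (originBall d R)) :=
      integrable_energyDensity T (hmem R hR0).memLp (hmem R hR0).memLp_grad
    have := integral_add i1 (integrable_const (T⁻¹ * R ^ 2))
    rw [setIntegral_const, smul_eq_mul, volume_real_originBall hR0] at this
    rw [show T⁻¹ * (R ^ (d + 2) * β) = R ^ d * β * (T⁻¹ * R ^ 2) by ring, ← this]
    rfl
  rw [hrhs]
  refine sqrt_le_mul_sqrt_of_le (by positivity) hC ?_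
  change ∫ x in originBall d 1, energyDensity T u Du x ≤ _
  have hp : 0 ≤ 2 * (T⁻¹ * (1 ^ (d + 2) * β)) := by positivity
  calc ∫ x in originBall d 1, energyDensity T u Du x
      ≤ (∫ x in originBall d 1, energyDensity T u Du x) + 2 * (T⁻¹ * (1 ^ (d + 2) * β)) := by
        linarith
    _ ≤ _ := h
    _ ≤ 2 * (R ^ (-α)) ^ 2 * (2 * ((∫ x in originBall d R, energyDensity T u Du x) +
          T⁻¹ * (R ^ (d + 2) * β))) := by
        gcongr
        linarith [hE0 R]
    _ = _ := by ring

/-- With `a k` the energy in `B_{K^k R}`, the decay gives `a k ≤ θ a (k+1) + q^k W`; since `θ q <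
1`, summation over all scales gives `a 0 ≤ W / (1 - θ q)`, and finite total energy removes the
remainder `θ^n a n`. -/
theorem HasEnergyDecay.sqrt_energy_le_weighted {d : ℕ} (hd : 2 ≤ d)
    {A : Euc d → (Euc d →L[ℝ] Euc d)} {θ α q C : ℝ} (hA : HasEnergyDecay A θ) (hθ0 : 0 < θ)
    (hθ1 : θ < 1) (hα : 0 < α) (hq : (5 * d : ℝ) ^ (2 * α) = q) (hq1 : 1 < q)
    (hθq : θ * q ^ 2 = 1) (hC : Real.sqrt (q / (q - 1)) ≤ C) {R T : ℝ} (hR : 0 < R) (hT : 0 < T)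
    {v : Euc d → ℝ} {Dv g : Euc d → Euc d} (hv : MemH1 Set.univ v Dv) (hg : MemLp g 2 volume)
    (heq : MassiveEq Set.univ T v (fun x => A x (Dv x) + g x)) :
    Real.sqrt (∫ x in originBall d R, energyDensity T v Dv x) ≤
      C * Real.sqrt (∫ x, (‖x‖ / R + 1) ^ (-2 * α) * ‖g x‖ ^ 2) := by
  have hd' : (2 : ℝ) ≤ d := by exact_mod_cast hd
  set K : ℝ := 5 * d with hK
  have hK1 : 2 ≤ K := by rw [hK]; linarith
  have hK0 : 0 < K := by linarith
  set W := ∫ x, (‖x‖ / R + 1) ^ (-2 * α) * ‖g x‖ ^ 2 with hW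
  have hbase : ∀ x : Euc d, 1 ≤ ‖x‖ / R + 1 := fun x => by
    have : 0 ≤ ‖x‖ / R := by positivity
    linarith
  have hwc : Continuous fun x : Euc d => (‖x‖ / R + 1) ^ (-2 * α) :=
    (by fun_prop : Continuous fun x : Euc d => ‖x‖ / R + 1).rpow_const fun x =>
      Or.inl (by linarith [hbase x])
  have hWi : Integrable fun x => (‖x‖ / R + 1) ^ (-2 * α) * ‖g x‖ ^ 2 := by
    refine (integrable_norm_sq hg).mono
      (hwc.aestronglyMeasurable.mul (hg.1.norm.fun_pow 2)) (Eventually.of_forall fun x => ?_)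
    rw [norm_mul]
    refine mul_le_of_le_one_left (norm_nonneg _) ?_
    rw [Real.norm_of_nonneg (Real.rpow_nonneg (by linarith [hbase x]) _)]
    exact Real.rpow_le_one_of_one_le_of_nonpos (hbase x) (by linarith)
  have hW0 : 0 ≤ W := integral_nonneg fun x =>
    mul_nonneg (Real.rpow_nonneg (by linarith [hbase x]) _) (by positivity)
  -- On this ball `|x|/R + 1 ≤ K^(k+1) + 1 ≤ K^(k+2)`, so the weight is at least `K^(-2α(k+2)) =
  -- q^(-(k+2))`.
  have hgW : ∀ k : ℕ, ∫ x in originBall d (K ^ (k + 1) * R), ‖g x‖ ^ 2 ≤ q ^ (k + 2) * W := by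
    intro k
    have hpt : ∀ x ∈ originBall d (K ^ (k + 1) * R),
        ‖g x‖ ^ 2 ≤ q ^ (k + 2) * ((‖x‖ / R + 1) ^ (-2 * α) * ‖g x‖ ^ 2) := by
      intro x hx
      have hx' : ‖x‖ < K ^ (k + 1) * R := mem_ball_zero_iff.1 hx
      have h1 : ‖x‖ / R ≤ K ^ (k + 1) := (div_le_iff₀ hR).2 hx'.le
      have h2 : 1 ≤ K ^ (k + 1) := one_le_pow₀ (by linarith)
      have h3 : ‖x‖ / R + 1 ≤ K ^ (k + 2) := by
        rw [pow_succ K (k + 1)]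
        nlinarith
      have h4 : (‖x‖ / R + 1) ^ (2 * α) ≤ q ^ (k + 2) := by
        calc (‖x‖ / R + 1) ^ (2 * α) ≤ (K ^ (k + 2)) ^ (2 * α) :=
              Real.rpow_le_rpow (by linarith [hbase x]) h3 (by positivity)
          _ = q ^ (k + 2) := by
              rw [← hq, ← Real.rpow_natCast, ← Real.rpow_natCast, ← Real.rpow_mul hK0.le,
                ← Real.rpow_mul hK0.le, mul_comm]
      have h5 : 0 < (‖x‖ / R + 1) ^ (2 * α) := Real.rpow_pos_of_pos (by linarith [hbase x]) _
      rw [neg_mul, Real.rpow_neg (by linarith [hbase x]), ← mul_assoc, ← div_eq_mul_inv]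
      exact le_mul_of_one_le_left (by positivity) ((one_le_div h5).2 h4)
    calc ∫ x in originBall d (K ^ (k + 1) * R), ‖g x‖ ^ 2
        ≤ ∫ x in originBall d (K ^ (k + 1) * R),
            q ^ (k + 2) * ((‖x‖ / R + 1) ^ (-2 * α) * ‖g x‖ ^ 2) :=
          setIntegral_mono_on (integrable_norm_sq hg).integrableOn
            (hWi.const_mul _).integrableOn measurableSet_ball hpt
      _ = q ^ (k + 2) * ∫ x in originBall d (K ^ (k + 1) * R),
            (‖x‖ / R + 1) ^ (-2 * α) * ‖g x‖ ^ 2 := integral_const_mul _ _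
      _ ≤ q ^ (k + 2) * W := by
          gcongr
          exact setIntegral_le_integral hWi (Eventually.of_forall fun x =>
            mul_nonneg (Real.rpow_nonneg (by linarith [hbase x]) _) (by positivity))
  set a : ℕ → ℝ := fun k => ∫ x in originBall d (K ^ k * R), energyDensity T v Dv x with ha
  have hstep : ∀ k, a k ≤ θ * (a (k + 1) + q ^ (k + 2) * W) := by
    intro k
    have h := hA (K ^ k * R) T (by positivity) hT v (fun _ => 0) Dv g
      (hv.mono (Set.subset_univ _)) MemLp.zero' (hg.restrict _)
      (fun η hη => by simpa using heq.mono (Set.subset_univ _) η hη)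
    have e : 5 * d * (K ^ k * R) = K ^ (k + 1) * R := by rw [hK]; ring
    rw [e] at h
    refine h.trans ?_
    gcongr
    simpa [energyDensity] using hgW k
  -- `θ q = 1/q`, so `M = 1 / (1 - θ q)` is the sum of the geometric series and the fixed point of
  -- `M = 1 + θ q M`.
  set M := q / (q - 1) with hM
  have hq0 : 0 < q - 1 := by linarith
  have hM0 : 0 ≤ M := by positivity
  have hMq : 1 + θ * q * M ≤ M := by
    have e : θ * q * M = θ * q ^ 2 / (q - 1) := by rw [hM]; ring
    rw [e, hθq, hM]
    apply le_of_eq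
    field_simp
    ring
  -- Subtracting the particular solution `M q^n W` turns the recursion into the homogeneous
  -- inequality `b n ≤ θ b (n+1)`.
  have hb : ∀ n, a 0 - M * W ≤ θ ^ n * (a n - M * (q ^ n * W)) := by
    intro n
    induction n with
    | zero => simp
    | succ n ih =>
      refine ih.trans ?_
      rw [pow_succ θ, mul_assoc]
      gcongr
      have h1 := hstep n
      have h2 : θ * (q ^ (n + 2) * W) = (θ * q ^ 2) * (q ^ n * W) := by ring
      have h3 : θ * (M * (q ^ (n + 1) * W)) = θ * q * M * (q ^ n * W) := by ring
      have h4 : (1 + θ * q * M) * (q ^ n * W) ≤ M * (q ^ n * W) := by gcongr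
      rw [hθq, one_mul] at h2
      linarith
  set E := ∫ x in Set.univ, energyDensity T v Dv x with hE
  have hlim : Tendsto (fun n : ℕ => θ ^ n * E) atTop (nhds 0) := by
    simpa using (tendsto_pow_atTop_nhds_zero_of_lt_one hθ0.le hθ1).mul_const E
  have hfin : a 0 - M * W ≤ 0 := by
    refine ge_of_tendsto' hlim fun n => (hb n).trans ?_
    gcongr
    have h1 : a n ≤ E := setIntegral_energyDensity_mono hT hv.memLp hv.memLp_grad
      (Set.subset_univ _)
    have h2 : 0 ≤ M * (q ^ n * W) := by positivity
    linarith
  have ha0 : a 0 = ∫ x in originBall d R, energyDensity T v Dv x := by simp [ha]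
  rw [ha0] at hfin
  calc Real.sqrt (∫ x in originBall d R, energyDensity T v Dv x)
      ≤ Real.sqrt (M * W) := Real.sqrt_le_sqrt (by linarith)
    _ = Real.sqrt M * Real.sqrt W := Real.sqrt_mul hM0 _
    _ ≤ C * Real.sqrt W := by gcongr

/-! ### Choice of the exponent and the constant -/

theorem mainTheorem9 (d : ℕ) (hd : 2 ≤ d) (lam : ℝ) (hlam0 : 0 < lam) (hlam1 : lam ≤ 1) :
    ∃ α : ℝ, 0 < α ∧ ∃ C : ℝ, 0 < C ∧
      ∀ A : Euc d → (Euc d →L[ℝ] Euc d), IsCoefficientField lam A →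
        -- decay of the energy of solutions of the homogeneous massive equation
        (∀ R T : ℝ, 1 ≤ R → 0 < T → ∀ (v : Euc d → ℝ) (Dv : Euc d → Euc d),
          MemH1 (originBall d R) v Dv →
          MassiveEq (originBall d R) T v (fun x => A x (Dv x)) →
          Real.sqrt (∫ x in originBall d 1, (T⁻¹ * (v x) ^ 2 + ‖Dv x‖ ^ 2)) ≤
            C * R ^ (-α) *
              Real.sqrt (∫ x in originBall d R, (T⁻¹ * (v x) ^ 2 + ‖Dv x‖ ^ 2))) ∧
        -- weighted energy estimate for the equation with right-hand side `∇ · g`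
        (∀ R T : ℝ, 0 < R → 0 < T →
          ∀ (v : Euc d → ℝ) (Dv : Euc d → Euc d) (g : Euc d → Euc d),
          MemH1 Set.univ v Dv → MemLp g 2 volume →
          MassiveEq Set.univ T v (fun x => A x (Dv x) + g x) →
          Real.sqrt (∫ x in originBall d R, (T⁻¹ * (v x) ^ 2 + ‖Dv x‖ ^ 2)) ≤
            C * Real.sqrt (∫ x, (‖x‖ / R + 1) ^ (-2 * α) * ‖g x‖ ^ 2)) ∧
        -- decay estimate for the modified corrector
        (∀ R T : ℝ, 1 ≤ R → 0 < T → ∀ ξ : Euc d, ‖ξ‖ = 1 →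
          ∀ (φ : Euc d → ℝ) (Dφ : Euc d → Euc d), IsModifiedCorrector A ξ T φ Dφ →
          Real.sqrt (∫ x in originBall d 1,
              (T⁻¹ * (inner ℝ ξ x + φ x) ^ 2 + ‖ξ + Dφ x‖ ^ 2)) ≤
            C * R ^ (-α) *
              Real.sqrt (∫ x in originBall d R,
                (T⁻¹ * (inner ℝ ξ x + φ x) ^ 2 + ‖ξ + Dφ x‖ ^ 2 + T⁻¹ * R ^ 2))) := by
  obtain ⟨θ, hθ, hθ1, hdecay⟩ := exists_hasEnergyDecay hd hlam0 hlam1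
  have hd' : (2 : ℝ) ≤ d := by exact_mod_cast hd
  have hθ0 : 0 < θ := by linarith
  -- Only half of the available decay is spent on the exponent: `q = θ⁻¹` would make `θ q = 1` and
  -- the series in (ii) diverge, whereas the square root gives `θ q = 1/q < 1`. Then `α` is fixed by
  -- `(5d)^(2α) = q`.
  set q : ℝ := Real.sqrt θ⁻¹ with hqdef
  have hq1 : 1 < q := by
    rw [hqdef, Real.lt_sqrt zero_le_one, one_pow]
    exact (one_lt_inv₀ hθ0).2 hθ1
  have hθq : θ * q ^ 2 = 1 := by
    rw [hqdef, Real.sq_sqrt (by positivity), mul_inv_cancel₀ hθ0.ne']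
  have hlog : 0 < Real.logb (5 * d) q := Real.logb_pos (by linarith) hq1
  have hq : (5 * d : ℝ) ^ (2 * (Real.logb (5 * d) q / 2)) = q := by
    rw [mul_div_cancel₀ _ two_ne_zero]
    exact Real.rpow_logb (by linarith) (by linarith) (by linarith)
  have hM : 0 ≤ Real.sqrt (q / (q - 1)) := Real.sqrt_nonneg _
  refine ⟨Real.logb (5 * d) q / 2, by positivity, 2 + Real.sqrt (q / (q - 1)), by positivity,
    fun A hA => ⟨?_, ?_, ?_⟩⟩
  · intro R T hR hT v Dv hv heq
    exact (hdecay A hA).sqrt_energy_le hd hθ (by positivity) hq hq1 hθq (by linarith) hR hT hv heq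
  · intro R T hR hT v Dv g hv hg heq
    exact (hdecay A hA).sqrt_energy_le_weighted hd hθ0 hθ1 (by positivity) hq hq1 hθq
      (by linarith) hR hT hv hg heq
  · intro R T hR hT ξ hξ φ Dφ hφ
    exact (hdecay A hA).sqrt_corrector_energy_le hd hθ (by positivity) hq hq1 hθq (by linarith)
      hR hT hξ hφ.memH1Loc hφ.equation
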